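/- Let $s,a\ge 1$ be integers, and let $C_s$ be the cyclic group of order $s$ with preferred generator $\tau$. Let $X_{s,a}$ be the pointed simplicial set generated by an $(s-1)$-simplex $x_0|x|\cdots|x$ ($s$ factors) and a base point $*$, with face and degeneracy maps as in the Hochschild complex (adjacent factors are multiplied; the last face multiplies the last factor onto the first one from the left; degeneracies insert the factor $1=x^0$), and with the relations $x^a=*$ and $x^{i-1}x_0x^{a-i}=*$ for $1\le i\le a$. Thus the $n$-simplices of $X_{s,a}$ other than $*$ are the words $$x^{i-1}x_0x^{k_0-i}\,|\,x^{k_1}\,|\cdots|\,x^{k_n},\qquad 1\le i\le k_0,\quad k_j\ge 0,\quad \textstyle\sum_j k_j=s,\quad k_j<a\text{ for all }j .$$ The group $C_s$ acts on the reduced normalized chain complex of $X_{s,a}$ by letting $\tau$ send a non-degenerate word as above to $x^{i-2}x_0x^{k_0-i+1}|x^{k_1}|\cdots|x^{k_n}$ if $i>1$ and to $(-1)^n\,x^{k_n-1}x_0|x^{k_0}|\cdots|x^{k_{n-1}}$ if $i=1$. Hence the reduced homology groups $\widetilde H_q(X_{s,a})$ are $\mathbb Z[C_s]$-modules. For $m\mid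 s$ let $C_m\subseteq C_s$ be the subgroup of order $m$, and put $d=\lfloor (s-1)/a\rfloor$. Then, as $\mathbb Z[C_s]$-modules: 1. If $a\nmid s$, then $\widetilde H_q(X_{s,a})$ is isomorphic to $\mathbb Z[C_s/C_s]=\mathbb Z$ (with trivial action) for $q=2d$, and is zero for all $q\neq 2d$. 2. If $a\mid s$, then $\widetilde H_q(X_{s,a})$ is isomorphic to the kernel of the map $\mathbb Z[C_s/C_{s/a}]\to\mathbb Z[C_s/C_s]$ induced by the projection for $q=2d+1$, and is zero for all $q\neq 2d+1$. -/

import Mathlib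

open CategoryTheory Opposite Simplicial

namespace PointedSSet

variable (X : SSet.{0}) (pt : X _⦋0⦌)

/-- The base point of `X` in degree `n`: the iterated degeneracy of the base vertex. -/
def basePt (n : ℕ) : X _⦋n⦌ := X.map (SimplexCategory.const ⦋n⦌ ⦋0⦌ 0).op pt

/-- The subgroup of `ℤ[X_n]` spanned by the degenerate simplices and the base point. -/
noncomputable def nullChains (n : ℕ) : Submodule ℤ (X _⦋n⦌ →₀ ℤ) :=
  Submodule.span ℤ ((fun x => Finsupp.single x 1) '' (X.degenerate n ∪ {basePt X pt n}))

/-- Reduced normalized `n`-chains of the pointed simplicial set `(X, pt)`: the free abelian group on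
the `n`-simplices modulo degenerate simplices and the base point. -/
abbrev Chains (n : ℕ) : Type := (X _⦋n⦌ →₀ ℤ) ⧸ nullChains X pt n

/-- The class of a simplex. -/
noncomputable def cls {n : ℕ} (x : X _⦋n⦌) : Chains X pt n :=
  (nullChains X pt n).mkQ (Finsupp.single x 1)

variable {X pt}

theorem cls_eq_zero_of_degenerate {n : ℕ} {x : X _⦋n⦌} (hx : x ∈ X.degenerate n) :
    cls X pt x = 0 :=
  (Submodule.Quotient.mk_eq_zero _).2 (Submodule.subset_span ⟨x, Or.inl hx, rfl⟩)

theorem cls_basePt (n : ℕ) : cls X pt (basePt X pt n) = 0 :=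
  (Submodule.Quotient.mk_eq_zero _).2 (Submodule.subset_span ⟨_, Or.inr rfl, rfl⟩)

theorem chains_hom_ext {n : ℕ} {M : Type} [AddCommGroup M] {f g : Chains X pt n →ₗ[ℤ] M}
    (h : ∀ x, f (cls X pt x) = g (cls X pt x)) : f = g := by
  apply Submodule.linearMap_qext
  ext x
  exact h x

variable (X pt)

/-- A linear map out of the reduced normalized chains, given on simplices. -/
noncomputable def liftChains {n : ℕ} {M : Type} [AddCommGroup M] (f : X _⦋n⦌ → M)
    (hdeg : ∀ x ∈ X.degenerate n, f x = 0) (hpt : f (basePt X pt n) = 0) :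
    Chains X pt n →ₗ[ℤ] M :=
  (nullChains X pt n).liftQ (Finsupp.linearCombination ℤ f) (by
    rw [nullChains, Submodule.span_le]
    rintro _ ⟨x, hx | hx, rfl⟩
    · simp [hdeg x hx]
    · rw [Set.mem_singleton_iff] at hx
      simp [hx, hpt])

@[simp] theorem liftChains_cls {n : ℕ} {M : Type} [AddCommGroup M] (f : X _⦋n⦌ → M)
    (hdeg : ∀ x ∈ X.degenerate n, f x = 0) (hpt : f (basePt X pt n) = 0) (x : X _⦋n⦌) :
    liftChains X pt f hdeg hpt (cls X pt x) = f x := by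
  simp [liftChains, cls]

theorem δ_basePt {n : ℕ} (i : Fin (n + 2)) : X.δ i (basePt X pt (n + 1)) = basePt X pt n := by
  simp only [basePt, SimplicialObject.δ, ← ConcreteCategory.comp_apply, ← X.map_comp, ← op_comp]
  rfl

theorem alternating_degenerate {n : ℕ} {x : X _⦋n + 1⦌} (hx : x ∈ X.degenerate (n + 1)) :
    ∑ i : Fin (n + 2), (-1 : ℤ) ^ (i : ℕ) • cls X pt (X.δ i x) = 0 := by
  rw [SSet.degenerate_eq_iUnion_range_σ, Set.mem_iUnion] at hx
  obtain ⟨j, y, rfl⟩ := hx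
  rw [Finset.sum_eq_add (j.castSucc) j.succ]
  · have h1 : X.δ j.castSucc (X.σ j y) = y :=
      ConcreteCategory.congr_hom (SimplicialObject.δ_comp_σ_self X (i := j)) y
    have h2 : X.δ j.succ (X.σ j y) = y :=
      ConcreteCategory.congr_hom (SimplicialObject.δ_comp_σ_succ X (i := j)) y
    rw [h1, h2]
    simp [pow_succ]
  · exact (Fin.castSucc_lt_succ).ne
  · rintro i - ⟨h1, h2⟩
    suffices h : X.δ i (X.σ j y) ∈ X.degenerate n by
      rw [cls_eq_zero_of_degenerate h, smul_zero]
    cases n with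
    | zero =>
      exfalso
      fin_cases j
      fin_cases i <;> simp_all
    | succ n =>
      rcases lt_or_gt_of_ne h1 with h | h
      · obtain ⟨k, rfl⟩ := Fin.eq_succ_of_ne_zero (i := j) (by rintro rfl; simp at h)
        obtain ⟨i', rfl⟩ := Fin.eq_castSucc_of_ne_last (x := i) (by rintro rfl; simp [Fin.lt_def] at h; omega)
        have := ConcreteCategory.congr_hom (SimplicialObject.δ_comp_σ_of_le X (i := i') (j := k)
          (by simp [Fin.lt_def, Fin.le_def] at h ⊢; omega)) y
        erw [this]
        exact SSet.σ_mem_degenerate _ _ _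
      · have h3 : j.succ < i := by
          simp [Fin.lt_def, Fin.ext_iff] at h h2 ⊢; omega
        obtain ⟨k, rfl⟩ := Fin.eq_castSucc_of_ne_last (x := j) (by
          rintro rfl; simp [Fin.lt_def] at h3; omega)
        obtain ⟨i', rfl⟩ := Fin.eq_succ_of_ne_zero (i := i) (by rintro rfl; simp at h3)
        have := ConcreteCategory.congr_hom (SimplicialObject.δ_comp_σ_of_gt X (i := i') (j := k)
          (by simp [Fin.lt_def] at h3 ⊢; omega)) y
        erw [this]
        exact SSet.σ_mem_degenerate _ _ _
  · simp
  · simp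

/-- The boundary `∑ (-1)^i d_i`. -/
noncomputable def boundary (n : ℕ) : Chains X pt (n + 1) →ₗ[ℤ] Chains X pt n :=
  liftChains X pt (fun x => ∑ i : Fin (n + 2), (-1 : ℤ) ^ (i : ℕ) • cls X pt (X.δ i x))
    (fun _ hx => alternating_degenerate X pt hx)
    (by simp [δ_basePt, cls_basePt])

@[simp] theorem boundary_cls {n : ℕ} (x : X _⦋n + 1⦌) :
    boundary X pt n (cls X pt x) =
      ∑ i : Fin (n + 2), (-1 : ℤ) ^ (i : ℕ) • cls X pt (X.δ i x) := by
  simp [boundary]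

theorem alternating_comp (n : ℕ) :
    (∑ i : Fin (n + 2), (-1 : ℤ) ^ (i : ℕ) • Finsupp.lmapDomain ℤ ℤ (X.δ i : _ → X _⦋n⦌)) ∘ₗ
      (∑ i : Fin (n + 3), (-1 : ℤ) ^ (i : ℕ) •
        Finsupp.lmapDomain ℤ ℤ (X.δ i : _ → X _⦋n + 1⦌)) = 0 := by
  have key : ∀ m : ℕ, ∃ D : ModuleCat.of ℤ (X _⦋m + 1⦌ →₀ ℤ) ⟶ ModuleCat.of ℤ (X _⦋m⦌ →₀ ℤ),
      D = AlgebraicTopology.AlternatingFaceMapComplex.objD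
        (((SimplicialObject.whiskering _ _).obj (ModuleCat.free ℤ)).obj X) m ∧
      D.hom = ∑ i : Fin (m + 2), (-1 : ℤ) ^ (i : ℕ) •
        Finsupp.lmapDomain ℤ ℤ (X.δ i : _ → X _⦋m⦌) := by
    intro m
    refine ⟨∑ i : Fin (m + 2), (-1 : ℤ) ^ (i : ℕ) •
      ModuleCat.ofHom (Finsupp.lmapDomain ℤ ℤ (X.δ i : _ → X _⦋m⦌)), rfl, ?_⟩
    simp [ModuleCat.hom_sum]
  obtain ⟨D, hD, hD'⟩ := key n
  obtain ⟨E, hE, hE'⟩ := key (n + 1)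
  have h : E ≫ D = 0 := by
    rw [hD, hE]
    exact AlgebraicTopology.AlternatingFaceMapComplex.d_squared _ n
  rw [← hD', ← hE', ← ModuleCat.hom_comp, h]
  rfl

theorem boundary_mkQ (n : ℕ) (y : X _⦋n + 1⦌ →₀ ℤ) :
    boundary X pt n ((nullChains X pt (n + 1)).mkQ y) = (nullChains X pt n).mkQ
      ((∑ i : Fin (n + 2), (-1 : ℤ) ^ (i : ℕ) •
        Finsupp.lmapDomain ℤ ℤ (X.δ i : _ → X _⦋n⦌)) y) := by
  induction y using Finsupp.induction_linear with
  | zero => simp only [map_zero]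
  | add f g hf hg => simp only [map_add, hf, hg]
  | single x r =>
    have h1 : Finsupp.single x r = r • Finsupp.single x (1 : ℤ) := by simp
    rw [h1, map_smul, map_smul, map_smul, map_smul]
    congr 1
    refine (boundary_cls X pt x).trans ?_
    rw [LinearMap.sum_apply, map_sum]
    refine Finset.sum_congr rfl fun i _ => ?_
    rw [LinearMap.smul_apply, map_smul, Finsupp.lmapDomain_apply, Finsupp.mapDomain_single]
    rfl

theorem boundary_boundary (n : ℕ) : boundary X pt n ∘ₗ boundary X pt (n + 1) = 0 := by
  apply Submodule.linearMap_qext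
  apply LinearMap.ext
  intro y
  rw [LinearMap.comp_apply, LinearMap.comp_apply, boundary_mkQ, boundary_mkQ]
  exact (congrArg (nullChains X pt n).mkQ
    (LinearMap.congr_fun (alternating_comp X n) y)).trans (map_zero _)

/-- The reduced normalized chain complex of a pointed simplicial set. -/
noncomputable def reducedChains : ChainComplex (ModuleCat.{0} ℤ) ℕ :=
  ChainComplex.of (fun n => ModuleCat.of ℤ (Chains X pt n))
    (fun n => ModuleCat.ofHom (boundary X pt n))
    (fun n => by rw [← ModuleCat.ofHom_comp, boundary_boundary]; rfl)

theorem reducedChains_d (n : ℕ) :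
    (reducedChains X pt).d (n + 1) n = ModuleCat.ofHom (boundary X pt n) :=
  ChainComplex.of_d (V := ModuleCat.{0} ℤ) (fun n => ModuleCat.of ℤ (Chains X pt n))
    (fun n => ModuleCat.ofHom (boundary X pt n)) n

/-- The reduced homology of a pointed simplicial set. -/
noncomputable abbrev reducedHomology (q : ℕ) : ModuleCat.{0} ℤ := (reducedChains X pt).homology q

end PointedSSet

namespace TruncatedBar

/-- The slot of the new word to which slot `l` of the old word contributes under the operator
`θ : [m] → [n]`: the least `j` with `l ≤ θ j`, and slot `0` if there is none (this is how the
last slots come around to the front, as in the last face of the Hochschild complex). -/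
noncomputable def slot {m n : ℕ} (θ : Fin (m + 1) →o Fin (n + 1)) (l : Fin (n + 1)) :
    Fin (m + 1) :=
  open Classical in if h : ∃ j, l ≤ θ j then Fin.find _ h else 0

theorem slot_le_iff {m n : ℕ} (θ : Fin (m + 1) →o Fin (n + 1)) {l : Fin (n + 1)}
    (hl : l ≤ θ (Fin.last m)) (j : Fin (m + 1)) : slot θ l ≤ j ↔ l ≤ θ j := by
  have h : ∃ j, l ≤ θ j := ⟨_, hl⟩
  rw [slot, dif_pos h]
  constructor
  · intro hj
    exact (Fin.find_spec h).trans (θ.monotone hj)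
  · intro hj
    exact Fin.find_le_of_pos h hj

theorem slot_of_gt {m n : ℕ} (θ : Fin (m + 1) →o Fin (n + 1)) {l : Fin (n + 1)}
    (hl : θ (Fin.last m) < l) : slot θ l = 0 := by
  rw [slot, dif_neg]
  rintro ⟨j, hj⟩
  exact absurd (hj.trans (θ.monotone (Fin.le_last j))) (not_le.2 hl)

theorem slot_zero {m n : ℕ} (θ : Fin (m + 1) →o Fin (n + 1)) : slot θ 0 = 0 :=
  le_antisymm ((slot_le_iff θ (Fin.zero_le _) 0).2 (Fin.zero_le _)) (Fin.zero_le _)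

theorem slot_id {n : ℕ} (l : Fin (n + 1)) : slot (OrderHom.id : Fin (n + 1) →o _) l = l := by
  apply le_antisymm
  · exact (slot_le_iff OrderHom.id (Fin.le_last l) l).2 le_rfl
  · exact (slot_le_iff OrderHom.id (Fin.le_last l) _).1 le_rfl

theorem slot_comp {p m n : ℕ} (θ : Fin (m + 1) →o Fin (n + 1)) (φ : Fin (p + 1) →o Fin (m + 1))
    (l : Fin (n + 1)) : slot (θ.comp φ) l = slot φ (slot θ l) := by
  by_cases h : l ≤ θ (φ (Fin.last p))
  · have h1 : l ≤ θ (Fin.last m) := h.trans (θ.monotone (Fin.le_last _))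
    have h2 : slot θ l ≤ φ (Fin.last p) := (slot_le_iff θ h1 _).2 h
    refine eq_of_forall_ge_iff fun j => ?_
    rw [slot_le_iff φ h2, slot_le_iff θ h1, slot_le_iff (θ.comp φ) h]
    rfl
  · rw [slot_of_gt (θ.comp φ) (not_le.1 h)]
    by_cases h1 : l ≤ θ (Fin.last m)
    · rw [slot_of_gt φ]
      rw [← not_le, slot_le_iff θ h1]
      exact h
    · rw [slot_of_gt θ (not_le.1 h1), slot_zero]

/-- A word `x^{i-1} x₀ x^{k₀-i} | x^{k₁} | ⋯ | x^{k_n}` of total degree `s`, with `1 ≤ i ≤ k₀`. -/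
@[ext]
structure Word (s n : ℕ) where
  /-- the degrees of the slots -/
  k : Fin (n + 1) → ℕ
  /-- the position of `x₀` in the slot `0` -/
  i : ℕ
  one_le_i : 1 ≤ i
  i_le : i ≤ k 0
  sum_k : ∑ j, k j = s

namespace Word

variable {s m n : ℕ}

/-- The simplicial operators on words, as in the Hochschild complex: neighbouring slots are
multiplied, units `x^0` are inserted, and the slots `l > θ(m)` are multiplied onto the slot `0`
from the left (which moves `x₀` to the right). In particular the face `d_c` with `c < n` multiplies
the slots `c` and `c + 1`, the last face `d_n` multiplies the slot `n` onto the slot `0` from the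
left, and the degeneracy `s_c` inserts a slot `x^0` after the slot `c`. -/
noncomputable def map (θ : Fin (m + 1) →o Fin (n + 1)) (w : Word s n) : Word s m where
  k j := ∑ l with slot θ l = j, w.k l
  i := w.i + ∑ l with θ (Fin.last m) < l, w.k l
  one_le_i := w.one_le_i.trans (Nat.le_add_right _ _)
  i_le := by
    have h0 : (0 : Fin (n + 1)) ∉ ({l | θ (Fin.last m) < l} : Finset (Fin (n + 1))) := by simp
    calc _ ≤ w.k 0 + ∑ l with θ (Fin.last m) < l, w.k l := by gcongr; exact w.i_le
      _ = ∑ l ∈ insert 0 ({l | θ (Fin.last m) < l} : Finset (Fin (n + 1))), w.k l :=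
        (Finset.sum_insert h0).symm
      _ ≤ _ := by
        refine Finset.sum_le_sum_of_subset fun l hl => ?_
        rw [Finset.mem_insert, Finset.mem_filter] at hl
        rw [Finset.mem_filter]
        rcases hl with rfl | hl
        · exact ⟨Finset.mem_univ _, slot_zero θ⟩
        · exact ⟨Finset.mem_univ _, slot_of_gt θ hl.2⟩
  sum_k := by rw [Finset.sum_fiberwise, w.sum_k]

theorem map_id (w : Word s n) : w.map OrderHom.id = w := by
  ext
  · simp [map, slot_id, Finset.filter_eq']
  · simp [map, not_lt.2 (Fin.le_last _)]

theorem map_comp {p : ℕ} (θ : Fin (m + 1) →o Fin (n + 1)) (φ : Fin (p + 1) →o Fin (m + 1))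
    (w : Word s n) : w.map (θ.comp φ) = (w.map θ).map φ := by
  ext j
  · simp only [map, slot_comp]
    rw [Finset.sum_filter, Finset.sum_filter, ← Finset.sum_fiberwise (g := slot θ)]
    refine Finset.sum_congr rfl fun q _ => ?_
    split_ifs with h
    · refine Finset.sum_congr rfl fun l hl => ?_
      rw [(Finset.mem_filter.1 hl).2, if_pos h]
    · refine Finset.sum_eq_zero fun l hl => ?_
      rw [(Finset.mem_filter.1 hl).2, if_neg h]
  · have key : ∑ l with θ (φ (Fin.last p)) < l, w.k l =
        ∑ l with θ (Fin.last m) < l, w.k l +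
          ∑ q with φ (Fin.last p) < q, ∑ l with slot θ l = q, w.k l := by
      rw [Finset.sum_filter (p := fun q => φ (Fin.last p) < q)]
      have : ∀ q, (if φ (Fin.last p) < q then ∑ l with slot θ l = q, w.k l else 0) =
          ∑ l with slot θ l = q, if φ (Fin.last p) < slot θ l then w.k l else 0 := by
        intro q
        split_ifs with h
        · refine Finset.sum_congr rfl fun l hl => ?_
          rw [(Finset.mem_filter.1 hl).2, if_pos h]
        · refine (Finset.sum_eq_zero fun l hl => ?_).symm
          rw [(Finset.mem_filter.1 hl).2, if_neg h]
      simp only [this]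
      rw [Finset.sum_fiberwise, Finset.sum_filter, Finset.sum_filter, ← Finset.sum_add_distrib]
      refine Finset.sum_congr rfl fun l _ => ?_
      by_cases h1 : l ≤ θ (Fin.last m)
      · have h2 : φ (Fin.last p) < slot θ l ↔ θ (φ (Fin.last p)) < l := by
          rw [← not_le, slot_le_iff θ h1, not_le]
        simp [h2, not_lt.2 h1]
      · rw [not_le] at h1
        have h2 : θ (φ (Fin.last p)) < l := (θ.monotone (Fin.le_last _)).trans_lt h1
        simp [slot_of_gt θ h1, h1, h2]
    simp only [map, add_assoc]
    exact congrArg (w.i + ·) key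

theorem k_le_map (θ : Fin (m + 1) →o Fin (n + 1)) (w : Word s n) (l : Fin (n + 1)) :
    w.k l ≤ (w.map θ).k (slot θ l) :=
  have hl : l ∈ ({l' | slot θ l' = slot θ l} : Finset (Fin (n + 1))) := by simp
  Finset.single_le_sum (f := w.k) (fun _ _ => Nat.zero_le _) hl

/-- All slots have degree `< a`, so that the word is not identified with the base point. -/
def Short (a : ℕ) (w : Word s n) : Prop := ∀ j, w.k j < a

theorem Short.of_map {a : ℕ} {θ : Fin (m + 1) →o Fin (n + 1)} {w : Word s n}
    (h : (w.map θ).Short a) : w.Short a :=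
  fun l => (k_le_map θ w l).trans_lt (h _)

end Word

/-- The `n`-simplices of `X_{s,a}`: words in which every slot has degree `< a`, and the base
point `none`. -/
abbrev Simplex (s a n : ℕ) : Type := Option {w : Word s n // w.Short a}

/-- The class of a word: the relations `x^a = *` and `x^{i-1} x₀ x^{a-i} = *` make a word with a
slot of degree `≥ a` equal to the base point. -/
noncomputable def Simplex.ofWord {s n : ℕ} (a : ℕ) (w : Word s n) : Simplex s a n :=
  open Classical in if h : w.Short a then some ⟨w, h⟩ else none

/-- The simplicial operators of `X_{s,a}`. -/
noncomputable def Simplex.map {s a m n : ℕ} (θ : Fin (m + 1) →o Fin (n + 1))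
    (x : Simplex s a n) : Simplex s a m :=
  x.elim none fun w => ofWord a (w.1.map θ)

theorem Simplex.map_ofWord {s a m n : ℕ} (θ : Fin (m + 1) →o Fin (n + 1)) (w : Word s n) :
    Simplex.map θ (ofWord a w) = ofWord a (w.map θ) := by
  by_cases h : w.Short a
  · simp [ofWord, h, Simplex.map]
  · have h' : ¬ (w.map θ).Short a := fun h' => h h'.of_map
    simp [ofWord, h, h', Simplex.map]

theorem Simplex.map_id {s a n : ℕ} (x : Simplex s a n) : Simplex.map OrderHom.id x = x := by
  cases x with
  | none => rfl
  | some w => simp [Simplex.map, Word.map_id, Simplex.ofWord, w.2]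

theorem Simplex.map_comp {s a p m n : ℕ} (θ : Fin (m + 1) →o Fin (n + 1))
    (φ : Fin (p + 1) →o Fin (m + 1)) (x : Simplex s a n) :
    Simplex.map (θ.comp φ) x = Simplex.map φ (Simplex.map θ x) := by
  cases x with
  | none => rfl
  | some w =>
    change Simplex.ofWord a (w.1.map (θ.comp φ)) =
      Simplex.map φ (Simplex.ofWord a (w.1.map θ))
    rw [Simplex.map_ofWord, Word.map_comp]

/-- The simplicial set `X_{s,a}`, generated by the `(s-1)`-simplex `x₀ | x | ⋯ | x` and a base point
`*`, with the operators of the Hochschild complex and the relations `x^a = *` and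
`x^{i-1} x₀ x^{a-i} = *`. -/
noncomputable def X (s a : ℕ) : SSet.{0} where
  obj Δ := Simplex s a Δ.unop.len
  map {Δ Δ'} θ := TypeCat.ofHom (Simplex.map (s := s) (a := a) (n := Δ.unop.len)
    (m := Δ'.unop.len) θ.unop.toOrderHom)
  map_id Δ := by
    apply ConcreteCategory.hom_ext
    exact Simplex.map_id
  map_comp θ φ := by
    apply ConcreteCategory.hom_ext
    exact Simplex.map_comp θ.unop.toOrderHom φ.unop.toOrderHom

/-- The base vertex `*` of `X_{s,a}`. -/
noncomputable def pt (s a : ℕ) : (X s a) _⦋0⦌ := Option.none (α := {w : Word s 0 // w.Short a})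

open PointedSSet

/-- The class in the reduced normalized chains of the simplex given by a word. -/
noncomputable def wcls {s n : ℕ} (a : ℕ) (w : Word s n) : Chains (X s a) (pt s a) n :=
  cls (X s a) (pt s a) (Simplex.ofWord a w)

section slots

variable {n : ℕ}

/-- The coface `[n] → [n+1]` that omits `c`. -/
def dOp (c : Fin (n + 2)) : Fin (n + 1) →o Fin (n + 2) := (Fin.succAboveOrderEmb c).toOrderHom

theorem slot_δ (c l : Fin (n + 2)) : (slot (dOp c) l : ℕ) =
    if (l : ℕ) ≤ c then (if (l : ℕ) = n + 1 then 0 else (l : ℕ)) else (l : ℕ) - 1 := by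
  have hv : ∀ q : Fin (n + 1), (((dOp c) q : Fin (n + 2)) : ℕ) =
      if (q : ℕ) < c then (q : ℕ) else q + 1 := by
    intro q
    change ((c.succAbove q : Fin (n + 2)) : ℕ) = _
    rw [Fin.succAbove]
    simp only [Fin.lt_def, Fin.val_castSucc]
    split_ifs <;> simp
  have hc := c.isLt
  have hl := l.isLt
  by_cases h : l ≤ (dOp c) (Fin.last n)
  · have h1 := fun q => slot_le_iff (dOp c) h q
    have h2 : (l : ℕ) ≤ if n < c then n else n + 1 := by
      have := hv (Fin.last n); rw [Fin.le_def, this] at h; simpa using h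
    have h3 : ∀ q, q < n + 1 → ((slot (dOp c) l : ℕ) ≤ q ↔
        (l : ℕ) ≤ if q < c then q else q + 1) := by
      intro q hq
      have := h1 ⟨q, hq⟩
      rwa [Fin.le_def, Fin.le_def, hv] at this
    have h4 := (slot (dOp c) l).isLt
    generalize (slot (dOp c) l : ℕ) = t at *
    have h5 := (h3 t h4).1 le_rfl
    rcases Nat.eq_zero_or_pos t with rfl | ht
    · split_ifs at * <;> omega
    · have h6 := mt (h3 (t - 1) (by omega)).2 (by omega)
      split_ifs at * <;> omega
  · rw [not_le] at h
    rw [slot_of_gt _ h]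
    rw [Fin.lt_def, hv] at h
    simp only [Fin.val_last, Fin.val_zero] at *
    split_ifs at * <;> omega

theorem δ_last (c : Fin (n + 2)) :
    (((dOp c) (Fin.last n) : Fin (n + 2)) : ℕ) =
      if (c : ℕ) = n + 1 then n else n + 1 := by
  change ((c.succAbove (Fin.last n) : Fin (n + 2)) : ℕ) = _
  have hc := c.isLt
  rw [Fin.succAbove]
  simp only [Fin.lt_def, Fin.val_castSucc, Fin.val_last]
  split_ifs <;> simp <;> omega

theorem val_add_one' (l : Fin (n + 1)) :
    ((l + 1 : Fin (n + 1)) : ℕ) = if (l : ℕ) = n then 0 else (l : ℕ) + 1 := by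
  rw [Fin.val_add_one]
  simp [Fin.ext_iff]

end slots

namespace Word

variable {s n : ℕ}

/-- `x^{i-1} x₀ x^{k₀-i} | ⋯ ↦ x^{i-2} x₀ x^{k₀-i+1} | ⋯`, for `i > 1`. -/
def shift (w : Word s n) (h : 1 < w.i) : Word s n where
  k := w.k
  i := w.i - 1
  one_le_i := by omega
  i_le := (Nat.sub_le _ _).trans w.i_le
  sum_k := w.sum_k

/-- `⋯ | x^{k_n} ↦ x^{k_n-1} x₀ | x^{k₀} | ⋯ | x^{k_{n-1}}`, for `k_n > 0`. The subtraction of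
indices is cyclic, in `Fin (n + 1)`. -/
def wrap (w : Word s n) (h : 0 < w.k (Fin.last n)) : Word s n where
  k j := w.k (j - 1)
  i := w.k (Fin.last n)
  one_le_i := h
  i_le := by
    have h : (0 - 1 : Fin (n + 1)) = Fin.last n := by
      rw [sub_eq_iff_eq_add, Fin.last_add_one]
    exact (congrArg w.k h).ge
  sum_k := by
    exact (Equiv.sum_comp (Equiv.subRight (1 : Fin (n + 1))) w.k).trans w.sum_k

theorem sum_wrap (w : Word s n) (h : 0 < w.k (Fin.last n)) (p q : Fin (n + 1) → Prop)
    [DecidablePred p] [DecidablePred q] (hpq : ∀ l, p l ↔ q (l + 1)) :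
    ∑ l with q l, (w.wrap h).k l = ∑ l with p l, w.k l := by
  symm
  refine Finset.sum_equiv (Equiv.addRight (1 : Fin (n + 1))) (fun l => ?_) (fun l _ => ?_)
  · simp [hpq]
  · simp [wrap]

theorem map_shift {m : ℕ} (w : Word s n) (h : 1 < w.i) (θ : Fin (m + 1) →o Fin (n + 1))
    (h' : 1 < (w.map θ).i) : (w.map θ).shift h' = (w.shift h).map θ := by
  ext
  · rfl
  · change w.i + _ - 1 = w.i - 1 + _
    simp only [shift]
    omega

theorem map_δ_i (w : Word s (n + 1)) (c : Fin (n + 2)) :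
    (w.map (dOp c)).i =
      w.i + if (c : ℕ) = n + 1 then w.k (Fin.last (n + 1)) else 0 := by
  change w.i + _ = _
  congr 1
  split_ifs with hc
  · rw [← Finset.sum_singleton w.k (Fin.last (n + 1))]
    congr 1
    ext l
    have := l.isLt
    simp only [Finset.mem_filter, Finset.mem_univ, true_and, Finset.mem_singleton, Fin.lt_def,
      Fin.ext_iff, Fin.val_last]
    rw [δ_last, if_pos hc]
    omega
  · rw [← Finset.sum_empty (f := w.k)]
    congr 1
    ext l
    have := l.isLt
    simp only [Finset.mem_filter, Finset.mem_univ, true_and, Fin.lt_def, Finset.notMem_empty,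
      iff_false]
    rw [δ_last, if_neg hc]
    omega

theorem shift_map_δ_last (w : Word s (n + 1)) (hi : w.i = 1) (h : 0 < w.k (Fin.last (n + 1)))
    (h' : 1 < (w.map (dOp (Fin.last (n + 1)))).i) :
    (w.map (dOp (Fin.last (n + 1)))).shift h' =
      (w.wrap h).map (dOp 0) := by
  ext q
  · refine (sum_wrap w h _ _ fun l => ?_).symm
    have := l.isLt
    rw [Fin.ext_iff, Fin.ext_iff, slot_δ, slot_δ]
    simp only [val_add_one', Fin.val_last, Fin.val_zero]
    split_ifs <;> omega
  · change (w.map _).i - 1 = _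
    rw [map_δ_i, map_δ_i]
    simp [hi, wrap]

theorem wrap_map_δ (w : Word s (n + 1)) (h : 0 < w.k (Fin.last (n + 1))) (j : Fin (n + 1))
    (h' : 0 < (w.map (dOp j.castSucc)).k (Fin.last n)) :
    (w.map (dOp j.castSucc)).wrap h' =
      (w.wrap h).map (dOp j.succ) := by
  have hj := j.isLt
  ext q
  · refine (sum_wrap w h _ _ fun l => ?_).symm
    have h1 : slot (dOp j.succ) (l + 1) = slot (dOp j.castSucc) l + 1 := by
      have := l.isLt
      rw [Fin.ext_iff, slot_δ, val_add_one', val_add_one', slot_δ]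
      simp only [Fin.val_succ, Fin.val_castSucc]
      split_ifs <;> omega
    rw [h1, eq_sub_iff_add_eq]
  · rw [map_δ_i]
    change ∑ l with slot (dOp j.castSucc) l = Fin.last n, w.k l = w.k (Fin.last (n + 1)) +
      if (j.succ : ℕ) = n + 1 then w.k (Fin.last (n + 1) - 1) else 0
    have hl : (Fin.last (n + 1) - 1 : Fin (n + 2)) = (Fin.last n).castSucc := by
      rw [sub_eq_iff_eq_add]
      simp
    have h1 : ∀ l : Fin (n + 2), slot (dOp j.castSucc) l = Fin.last n ↔
        l = Fin.last (n + 1) ∨ ((j.succ : ℕ) = n + 1 ∧ l = (Fin.last n).castSucc) := by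
      intro l
      have := l.isLt
      rw [Fin.ext_iff, slot_δ, Fin.ext_iff, Fin.ext_iff]
      simp only [Fin.val_succ, Fin.val_castSucc, Fin.val_last]
      split_ifs <;> omega
    simp only [h1, hl]
    split_ifs with hc
    · have h2 : ({l | l = Fin.last (n + 1) ∨ ((j.succ : ℕ) = n + 1 ∧ l = (Fin.last n).castSucc)} :
          Finset (Fin (n + 2))) = {Fin.last (n + 1), (Fin.last n).castSucc} := by
        ext l; simp [hc, -Fin.val_succ]
      rw [h2, Finset.sum_pair (by simp [Fin.ext_iff])]
    · have h2 : ({l | l = Fin.last (n + 1) ∨ ((j.succ : ℕ) = n + 1 ∧ l = (Fin.last n).castSucc)} :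
          Finset (Fin (n + 2))) = {Fin.last (n + 1)} := by
        ext l; simp [hc, -Fin.val_succ]
      rw [h2, Finset.sum_singleton, add_zero]

end Word

theorem basePt_eq (s a n : ℕ) : basePt (X s a) (pt s a) n =
    Option.none (α := {w : Word s n // w.Short a}) := rfl

theorem δ_ofWord {s a n : ℕ} (c : Fin (n + 2)) (w : Word s (n + 1)) :
    (X s a).δ c (Simplex.ofWord a w) = Simplex.ofWord a (w.map (dOp c)) :=
  Simplex.map_ofWord (dOp c) w

theorem wcls_of_not_short {s n a : ℕ} {w : Word s n} (h : ¬ w.Short a) : wcls a w = 0 := by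
  rw [wcls, Simplex.ofWord, dif_neg h]
  exact cls_basePt n

theorem Word.exists_k_eq_zero {s m n : ℕ} (hmn : n < m) (θ : Fin (m + 1) →o Fin (n + 1))
    (w : Word s n) : ∃ l, (w.map θ).k l = 0 := by
  by_contra! h
  have hs : Function.Surjective (slot θ) := by
    intro j
    by_contra! hj
    apply h j
    change ∑ l with slot θ l = j, w.k l = 0
    refine Finset.sum_eq_zero fun l hl => ?_
    exact absurd (Finset.mem_filter.1 hl).2 (hj l)
  have := Fintype.card_le_of_surjective _ hs
  simp only [Fintype.card_fin] at this
  omega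

theorem exists_k_eq_zero_of_degenerate {s a n : ℕ} {w : Word s n} (hw : w.Short a)
    (h : Simplex.ofWord a w ∈ (X s a).degenerate n) : ∃ l, w.k l = 0 := by
  obtain ⟨m, hm, f, y, hy⟩ := h
  change Simplex.map f.toOrderHom (show Simplex s a m from y) = _ at hy
  cases y with
  | none => simp [Simplex.map, Simplex.ofWord, hw] at hy
  | some v =>
    change Simplex.ofWord a (v.1.map f.toOrderHom) = _ at hy
    have h1 : v.1.map f.toOrderHom = w := by
      by_cases h2 : (v.1.map f.toOrderHom).Short a
      · simpa [Simplex.ofWord, hw, h2] using hy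
      · simp [Simplex.ofWord, hw, h2] at hy
    rw [← h1]
    exact Word.exists_k_eq_zero hm _ _

theorem Word.k_zero_pos {s n : ℕ} (w : Word s n) : 0 < w.k 0 := w.one_le_i.trans w.i_le

/-- The codegeneracy `[n+1] → [n]` that repeats `j`. -/
def sOp {n : ℕ} (j : Fin (n + 1)) : Fin (n + 2) →o Fin (n + 1) :=
  ⟨j.predAbove, Fin.predAbove_right_monotone j⟩

theorem Word.map_map_of_k_eq_zero {s n : ℕ} (w : Word s (n + 1)) (j : Fin (n + 1))
    (h : w.k j.succ = 0) : (w.map (dOp j.succ)).map (sOp j) = w := by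
  rw [← Word.map_comp]
  set θ : Fin (n + 2) →o Fin (n + 2) := (dOp j.succ).comp (sOp j) with hθ
  have hv : ∀ q, ((θ q : Fin (n + 2)) : ℕ) = if (q : ℕ) = j + 1 then (j : ℕ) else q := by
    intro q
    change ((j.succ.succAbove (j.predAbove q) : Fin (n + 2)) : ℕ) = _
    rw [Fin.succAbove, Fin.predAbove]
    simp only [Fin.lt_def, Fin.val_castSucc, Fin.val_succ]
    split_ifs <;> simp_all <;> omega
  have hlast : ∀ l, l ≠ j.succ → l ≤ θ (Fin.last (n + 1)) := by
    intro l hl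
    have := l.isLt
    have := j.isLt
    rw [Fin.le_def, hv]
    rw [ne_eq, Fin.ext_iff, Fin.val_succ] at hl
    rw [Fin.val_last]
    split_ifs <;> omega
  have hs : ∀ l, l ≠ j.succ → slot θ l = l := by
    intro l hl
    refine eq_of_forall_ge_iff fun q => ?_
    rw [slot_le_iff θ (hlast l hl), Fin.le_def, Fin.le_def, hv]
    rw [ne_eq, Fin.ext_iff, Fin.val_succ] at hl
    split_ifs <;> omega
  ext q
  · change ∑ l with slot θ l = q, w.k l = w.k q
    rw [Finset.sum_filter, Finset.sum_eq_single q]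
    · by_cases hq : q = j.succ
      · rw [hq, h]; simp
      · rw [if_pos (hs q hq)]
    · intro l _ hl
      by_cases hq : l = j.succ
      · rw [hq, h]; simp
      · rw [if_neg]
        rwa [hs l hq]
    · simp
  · change w.i + ∑ l with θ (Fin.last _) < l, w.k l = w.i
    rw [Finset.sum_eq_zero, add_zero]
    intro l hl
    by_cases hq : l = j.succ
    · rw [hq, h]
    · exact absurd (Finset.mem_filter.1 hl).2 (not_lt.2 (hlast l hq))

theorem degenerate_of_k_eq_zero {s a n : ℕ} {w : Word s n} {l : Fin (n + 1)} (h : w.k l = 0) :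
    Simplex.ofWord a w ∈ (X s a).degenerate n := by
  have hl : l ≠ 0 := by
    rintro rfl
    exact w.k_zero_pos.ne' h
  cases n with
  | zero => exact absurd (Fin.ext (by omega)) hl
  | succ n =>
    obtain ⟨j, rfl⟩ := Fin.eq_succ_of_ne_zero hl
    rw [← w.map_map_of_k_eq_zero j h, ← Simplex.map_ofWord]
    exact SSet.σ_mem_degenerate (X s a) j (Simplex.ofWord a (w.map (dOp j.succ)))

theorem wcls_of_k_eq_zero {s a n : ℕ} {w : Word s n} {l : Fin (n + 1)} (h : w.k l = 0) :
    wcls a w = 0 :=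
  cls_eq_zero_of_degenerate (degenerate_of_k_eq_zero h)

/-- The action of the generator `τ` of the cyclic group on (the class of) a word:
`τ (x^{i-1} x₀ x^{k₀-i} | x^{k₁} | ⋯ | x^{k_n})` is `x^{i-2} x₀ x^{k₀-i+1} | x^{k₁} | ⋯ | x^{k_n}` if
`i > 1`, and `(-1)^n x^{k_n-1} x₀ | x^{k₀} | ⋯ | x^{k_{n-1}}` if `i = 1`. (If `i = 1` and `k_n = 0`
the word is degenerate, so that its class is `0`.) -/
noncomputable def rotWord {s n : ℕ} (a : ℕ) (w : Word s n) : Chains (X s a) (pt s a) n :=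
  if h : 1 < w.i then wcls a (w.shift h)
  else if h' : 0 < w.k (Fin.last n) then (-1 : ℤ) ^ n • wcls a (w.wrap h')
  else 0

theorem rotWord_of_not_short {s n a : ℕ} {w : Word s n} (h : ¬ w.Short a) : rotWord a w = 0 := by
  rw [rotWord]
  split_ifs with h1 h2
  · exact wcls_of_not_short h
  · rw [wcls_of_not_short, smul_zero]
    intro h3
    refine h fun l => ?_
    simpa [Word.wrap] using h3 (l + 1)
  · rfl

theorem rotWord_of_k_eq_zero {s n a : ℕ} {w : Word s n} {l : Fin (n + 1)} (h : w.k l = 0) :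
    rotWord a w = 0 := by
  rw [rotWord]
  split_ifs with h1 h2
  · exact wcls_of_k_eq_zero (w := w.shift h1) h
  · rw [wcls_of_k_eq_zero (w := w.wrap h2) (l := l + 1), smul_zero]
    simpa [Word.wrap] using h
  · rfl

/-- The map `τ` on simplices, with `τ(*) = 0`. -/
noncomputable def rotSimplex {s a n : ℕ} (x : Simplex s a n) : Chains (X s a) (pt s a) n :=
  x.elim 0 fun w => rotWord a w.1

theorem rotSimplex_ofWord {s a n : ℕ} (w : Word s n) :
    rotSimplex (Simplex.ofWord a w) = rotWord a w := by
  by_cases h : w.Short a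
  · simp [rotSimplex, Simplex.ofWord, h]
  · simp [rotSimplex, Simplex.ofWord, h, rotWord_of_not_short]

/-- The map `τ` on the reduced normalized chains of `X_{s,a}`. -/
noncomputable def rot (s a n : ℕ) :
    Chains (X s a) (pt s a) n →ₗ[ℤ] Chains (X s a) (pt s a) n :=
  liftChains (X s a) (pt s a) (rotSimplex (s := s) (a := a) (n := n))
    (fun (x : Simplex s a n) hx => by
      cases x with
      | none => rfl
      | some w =>
        have h1 : some w = Simplex.ofWord a w.1 := by simp [Simplex.ofWord, w.2]
        rw [h1] at hx
        obtain ⟨l, hl⟩ := exists_k_eq_zero_of_degenerate w.2 hx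
        exact rotWord_of_k_eq_zero hl)
    rfl

theorem rot_wcls {s a n : ℕ} (w : Word s n) : rot s a n (wcls a w) = rotWord a w :=
  (liftChains_cls _ _ _ _ _ _).trans (rotSimplex_ofWord w)

theorem chains_ext {s a n : ℕ} {M : Type} [AddCommGroup M]
    {f g : Chains (X s a) (pt s a) n →ₗ[ℤ] M}
    (h : ∀ w : Word s n, w.Short a → (∀ l, 0 < w.k l) → f (wcls a w) = g (wcls a w)) : f = g := by
  apply chains_hom_ext
  intro (x : Simplex s a n)
  cases x with
  | none =>
    have h0 : cls (X s a) (pt s a) (Option.none (α := {w : Word s n // w.Short a})) = 0 :=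
      cls_basePt n
    exact (congrArg f h0).trans ((map_zero f).trans ((map_zero g).symm.trans
      (congrArg g h0.symm)))
  | some w =>
    have h1 : cls (X s a) (pt s a) (some w : Simplex s a n) = wcls a w.1 := by
      simp [wcls, Simplex.ofWord, w.2]
    refine (congrArg f h1).trans (Eq.trans ?_ (congrArg g h1.symm))
    by_cases hw : ∀ l, 0 < w.1.k l
    · exact h _ w.2 hw
    · push Not at hw
      obtain ⟨l, hl⟩ := hw
      rw [wcls_of_k_eq_zero (Nat.le_zero.1 hl), map_zero, map_zero]

theorem boundary_wcls {s a n : ℕ} (w : Word s (n + 1)) :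
    boundary (X s a) (pt s a) n (wcls a w) =
      ∑ c : Fin (n + 2), (-1 : ℤ) ^ (c : ℕ) • wcls a (w.map (dOp c)) :=
  (boundary_cls _ _ _).trans (Finset.sum_congr rfl fun c _ =>
    congrArg (fun y => (-1 : ℤ) ^ (c : ℕ) • cls (X s a) (pt s a) y) (δ_ofWord c w))

theorem rot_boundary (s a n : ℕ) : rot s a n ∘ₗ boundary (X s a) (pt s a) n =
    boundary (X s a) (pt s a) n ∘ₗ rot s a (n + 1) := by
  refine chains_ext fun w _ hw => ?_
  rw [LinearMap.comp_apply, LinearMap.comp_apply, boundary_wcls, rot_wcls, map_sum]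
  simp only [map_smul, rot_wcls]
  by_cases hi : 1 < w.i
  · rw [rotWord, dif_pos hi, boundary_wcls]
    refine Finset.sum_congr rfl fun c _ => ?_
    have h' : 1 < (w.map (dOp c)).i := hi.trans_le (Nat.le_add_right _ _)
    rw [rotWord, dif_pos h', Word.map_shift w hi]
  · have hi1 : w.i = 1 := le_antisymm (not_lt.1 hi) w.one_le_i
    rw [rotWord, dif_neg hi, dif_pos (hw _), map_smul, boundary_wcls, Fin.sum_univ_castSucc]
    conv_rhs => rw [Fin.sum_univ_succ]
    rw [smul_add, add_comm]
    congr 1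
    · have h' : 1 < (w.map (dOp (Fin.last (n + 1)))).i := by
        have := hw (Fin.last (n + 1))
        rw [Word.map_δ_i, hi1]
        simpa using this
      rw [rotWord, dif_pos h', Word.shift_map_δ_last w hi1 (hw _)]
      simp
    · rw [Finset.smul_sum]
      refine Finset.sum_congr rfl fun j _ => ?_
      have hj := j.isLt
      have h1 : ¬ 1 < (w.map (dOp j.castSucc)).i := by
        rw [Word.map_δ_i, hi1, if_neg]
        · simp
        · simp; omega
      have h2 : 0 < (w.map (dOp j.castSucc)).k (Fin.last n) := by
        refine (hw (Fin.last (n + 1))).trans_le ?_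
        have h3 : slot (dOp j.castSucc) (Fin.last (n + 1)) = Fin.last n := by
          rw [Fin.ext_iff, slot_δ]
          simp only [Fin.val_castSucc, Fin.val_last]
          split_ifs <;> omega
        have := Word.k_le_map (dOp j.castSucc) w (Fin.last (n + 1))
        rwa [h3] at this
      rw [rotWord, dif_neg h1, dif_pos h2, Word.wrap_map_δ w (hw _), smul_smul, smul_smul]
      congr 1
      simp only [Fin.val_succ, Fin.val_castSucc]
      ring

section

open scoped Fin.NatCast Fin.CommRing

namespace Word

variable {s n : ℕ}

/-- The word with the same slots in which `x₀` is the last letter of the slot `0`. -/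
def full (w : Word s n) : Word s n where
  k := w.k
  i := w.k 0
  one_le_i := w.k_zero_pos
  i_le := le_rfl
  sum_k := w.sum_k

theorem sub_last (c : ℕ) :
    (0 - ((c + 1 : ℕ) : Fin (n + 1))) = Fin.last n - (c : Fin (n + 1)) := by
  have h : (0 - 1 : Fin (n + 1)) = Fin.last n := by
    rw [sub_eq_iff_eq_add, Fin.last_add_one]
  rw [← h, Nat.cast_succ, sub_sub, add_comm (c : Fin (n + 1)) 1]

/-- The cyclic rotation of the slots by `c` places, with `x₀` last in the slot `0`. -/
def turn (w : Word s n) (hw : ∀ l, 0 < w.k l) (c : ℕ) : Word s n where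
  k j := w.k (j - (c : Fin (n + 1)))
  i := w.k (0 - (c : Fin (n + 1)))
  one_le_i := hw _
  i_le := le_rfl
  sum_k := (Equiv.sum_comp (Equiv.subRight (c : Fin (n + 1))) w.k).trans w.sum_k

end Word

theorem rot_pow_shift {s a n : ℕ} (t : ℕ) : ∀ (w v : Word s n), v.k = w.k → v.i + t = w.i →
    ((rot s a n) ^ t) (wcls a w) = wcls a v := by
  induction t with
  | zero =>
    intro w v hk hi
    have : v = w := Word.ext hk hi
    rw [this, pow_zero, Module.End.one_apply]
  | succ t ih =>
    intro w v hk hi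
    have h1 : 1 < w.i := by have := v.one_le_i; omega
    rw [pow_succ, Module.End.mul_apply, rot_wcls, rotWord, dif_pos h1]
    refine ih (w.shift h1) v hk ?_
    change _ = w.i - 1
    omega

theorem rot_pow_turn {s a n : ℕ} (w : Word s n) (hw : ∀ l, 0 < w.k l) (c : ℕ) :
    ((rot s a n) ^ (w.k (0 - (c : Fin (n + 1))))) (wcls a (w.turn hw c)) =
      (-1 : ℤ) ^ n • wcls a (w.turn hw (c + 1)) := by
  obtain ⟨t, ht⟩ : ∃ t, w.k (0 - (c : Fin (n + 1))) = t + 1 :=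
    ⟨w.k (0 - (c : Fin (n + 1))) - 1, by have := hw (0 - (c : Fin (n + 1))); omega⟩
  let v : Word s n :=
    { k := (w.turn hw c).k
      i := 1
      one_le_i := le_rfl
      i_le := hw _
      sum_k := (w.turn hw c).sum_k }
  have hv : ((rot s a n) ^ t) (wcls a (w.turn hw c)) = wcls a v := by
    refine rot_pow_shift t _ v rfl ?_
    change 1 + t = w.k (0 - (c : Fin (n + 1)))
    omega
  have h1 : ¬ 1 < v.i := lt_irrefl 1
  have h2 : 0 < v.k (Fin.last n) := hw _
  rw [ht, pow_succ', Module.End.mul_apply, hv, rot_wcls, rotWord, dif_neg h1, dif_pos h2]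
  congr 2
  ext j
  · change w.k (j - 1 - (c : Fin (n + 1))) = w.k (j - ((c + 1 : ℕ) : Fin (n + 1)))
    rw [Nat.cast_succ, sub_sub, add_comm (c : Fin (n + 1)) 1]
  · change w.k (Fin.last n - (c : Fin (n + 1))) = w.k (0 - ((c + 1 : ℕ) : Fin (n + 1)))
    rw [Word.sub_last]

theorem rot_pow_sum {s a n : ℕ} (w : Word s n) (hw : ∀ l, 0 < w.k l) (c : ℕ) :
    ((rot s a n) ^ (∑ b ∈ Finset.range c, w.k (0 - (b : Fin (n + 1))))) (wcls a (w.turn hw 0)) =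
      (((-1 : ℤ) ^ n) ^ c) • wcls a (w.turn hw c) := by
  induction c with
  | zero => simp
  | succ c ih =>
    rw [Finset.sum_range_succ, add_comm, pow_add, Module.End.mul_apply, ih, map_smul,
      rot_pow_turn, smul_smul, ← pow_succ]

/-- `τ` generates an action of the cyclic group of order `s`. -/
theorem rot_pow (s a n : ℕ) : (rot s a n) ^ s = 1 := by
  refine chains_ext fun w _ hw => ?_
  have hfull : ((rot s a n) ^ s) (wcls a (w.turn hw 0)) = wcls a (w.turn hw 0) := by
    have h := rot_pow_sum (a := a) w hw (n + 1)
    have hs : ∑ b ∈ Finset.range (n + 1), w.k (0 - (b : Fin (n + 1))) = s := by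
      rw [Finset.sum_range]
      simp only [Fin.cast_val_eq_self]
      exact (Equiv.sum_comp (Equiv.subLeft (0 : Fin (n + 1))) w.k).trans w.sum_k
    have ht : w.turn hw (n + 1) = w.turn hw 0 := by
      have h0 : (((n + 1 : ℕ)) : Fin (n + 1)) = ((0 : ℕ) : Fin (n + 1)) := by
        simp
      simp only [Word.turn, h0]
    have hsign : ((-1 : ℤ) ^ n) ^ (n + 1) = 1 := by
      rw [← pow_mul]
      exact (Nat.even_mul_succ_self n).neg_one_pow
    rwa [hs, ht, hsign, one_smul] at h
  have hw' : ((rot s a n) ^ (w.k 0 - w.i)) (wcls a (w.turn hw 0)) = wcls a w := by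
    refine rot_pow_shift _ _ w ?_ ?_
    · funext j
      simp [Word.turn]
    · have := w.i_le
      simp only [Word.turn, Nat.cast_zero, sub_zero]
      omega
  rw [← hw', ← Module.End.mul_apply, ← pow_add, add_comm, pow_add, Module.End.mul_apply, hfull,
    Module.End.one_apply]

end

/-- The chain map `τ`. -/
noncomputable def rotation (s a : ℕ) :
    End (reducedChains (X s a) (pt s a)) :=
  ChainComplex.ofHom (fun n => ModuleCat.ofHom (rot s a n)) (fun n =>
    (congrArg (ModuleCat.ofHom (rot s a (n + 1)) ≫ ·) (reducedChains_d _ _ n)).trans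
      ((congrArg ModuleCat.ofHom (rot_boundary s a n).symm).trans
        (congrArg (· ≫ ModuleCat.ofHom (rot s a n)) (reducedChains_d _ _ n)).symm))

theorem rotation_f (s a n : ℕ) : (rotation s a).f n = ModuleCat.ofHom (rot s a n) := rfl

theorem rotation_pow_f (s a : ℕ) (t n : ℕ) :
    ((rotation s a) ^ t).f n = ModuleCat.ofHom ((rot s a n) ^ t) := by
  induction t with
  | zero => rfl
  | succ t ih =>
    rw [pow_succ, End.mul_def, HomologicalComplex.comp_f, ih, pow_succ, rotation_f]
    rfl

theorem rotation_pow (s a : ℕ) : (rotation s a) ^ s = 1 := by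
  apply HomologicalComplex.hom_ext
  intro n
  rw [rotation_pow_f, rot_pow]
  rfl

/-- The action of the cyclic group `C_s` on the reduced normalized chains of `X_{s,a}`, in which
the generator acts by `τ`. -/
noncomputable def cyclicAction (s a : ℕ) [NeZero s] :
    Multiplicative (ZMod s) →* End (reducedChains (X s a) (pt s a)) where
  toFun g := (rotation s a) ^ (g.toAdd.val)
  map_one' := by simp
  map_mul' g h := by
    rw [toAdd_mul, ZMod.val_add, ← pow_add]
    conv_rhs => rw [← Nat.mod_add_div ((Multiplicative.toAdd g).val + (Multiplicative.toAdd h).val) s,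
      pow_add, pow_mul, rotation_pow, one_pow, mul_one]

/-- The reduced homology of `X_{s,a}` in degree `q`, as a representation of `C_s`, that is, as a
`ℤ[C_s]`-module. -/
noncomputable def homologyRep (s a : ℕ) [NeZero s] (q : ℕ) :
    Rep.{0} ℤ (Multiplicative (ZMod s)) :=
  Rep.of (X := reducedHomology (X s a) (pt s a) q)
    ((ModuleCat.endRingEquiv (reducedHomology (X s a) (pt s a) q)).toMonoidHom.comp
      (((HomologicalComplex.homologyFunctor (ModuleCat.{0} ℤ) (ComplexShape.down ℕ) q).mapEnd
        (reducedChains (X s a) (pt s a))).comp (cyclicAction s a)))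

end TruncatedBar

/-- The subgroup `C_m` of the cyclic group `C_s`, for `m ∣ s`: it is generated by `τ^{s/m}`. -/
def cyclicSubgroup (s m : ℕ) : Subgroup (Multiplicative (ZMod s)) :=
  Subgroup.zpowers (Multiplicative.ofAdd ((s / m : ℕ) : ZMod s))

/-- The permutation module `ℤ[G/H]`. -/
noncomputable abbrev cosetRep {G : Type} [Group G] (H : Subgroup G) : Rep.{0} ℤ G :=
  Rep.ofMulAction ℤ G (G ⧸ H)

/-- The map `ℤ[G/H] → ℤ[G/K]` induced by the projection `G/H → G/K`, for `H ≤ K`. -/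
noncomputable def cosetRepMap {G : Type} [Group G] {H K : Subgroup G} (h : H ≤ K) :
    cosetRep H ⟶ cosetRep K :=
  Rep.ofHom
    { toLinearMap := MonoidAlgebra.mapDomainLinearMap ℤ ℤ (Subgroup.quotientMapOfLE h)
      isIntertwining' := fun g => by
        ext x
        induction x using QuotientGroup.induction_on with | H x => ?_
        simp }

/-!
The non-degenerate words of total degree `s` are the ways of cutting a cyclic word of length `s`
with one marked letter `x₀`, no piece having length `a` or more. Let `C(s)` be the reduced
normalized chains of `X_{s,a}`. The proof rests on a periodicity `H_{q+2}(C(s+a)) ≅ H_q(C(s))`,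
compatible with the rotation, which reduces everything to `1 ≤ s ≤ a`. It reflects the two-periodic
resolution of `ℤ[x]/x^a` over its enveloping algebra, but is proved by explicit formulas.

* `cap : C(s+a)_{n+2} → C(s)_n` removes the last two slots `x^u | x^v` if `u + v ≥ a` and multiplies
  `x^{u+v-a}` onto the slot `0`; all other words go to `0`. It is a chain map (`cap_boundary`).
* `cup : C(s)_n → C(s+a)_{n+2}` is a chain map in the other direction with `cap ∘ cup = 1`
  (`cap_cup`) and `cap ∘ τ ∘ cup = τ` (`cap_rot_cup`).
* A cycle killed by `cap` is a boundary (`mem_range_boundary_of_cap_eq_zero`). The homotopy `homot`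
  splits off the last letter of a word. By `defect_gen_succ`, the operator `1 - ∂h - h∂` moves `x₀`
  to a strictly higher position, except for words whose last two slots multiply to `x^a`, and
  on the kernel of `cap` these contributions cancel up to higher positions. As the position of `x₀`
  is less than `a`, iterating `1 - ∂h - h∂` kills a cycle in the kernel of `cap`
  (`mem_range_boundary_of_defect`).

For `1 ≤ s < a` the complex `C(s)` is the chain complex of a simplex, with homology `ℤ` in degree
`0` (`homologyModelOfLt`). For `s = a` it is the chain complex of a simplex modulo its `a` vertices,
with homology the augmentation kernel of `ℤ[ℤ/a]` in degree `1` (`homologyModelOfEq`), on which `τ`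
acts by translation. Both follow from the same homotopy. Finally `ℤ[ℤ/a]` is identified with the
permutation module `ℤ[C_s/C_{s/a}]` by `cosetAddEquiv`, and a model of the homology of chains is
compared with the representation on homology by `HomologyModel.repAddHom`.
-/

namespace TruncatedBar

open PointedSSet

/-! ### Generators of the chain complex -/

/-- The word `x^{i-1} x₀ x^{f 0 - i} | x^{f 1} | ⋯ | x^{f n}` makes sense and has total degree `s`.
Slot degrees are recorded by a function on all of `ℕ`, of which only the values at `0, …, n` matter;
this keeps index arithmetic out of `Fin`. -/
structure IsWord (s n i : ℕ) (f : ℕ → ℕ) : Prop where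
  one_le : 1 ≤ i
  le : i ≤ f 0
  sum_eq : ∑ j ∈ Finset.range (n + 1), f j = s

/-- The word with slot degrees `f 0, …, f n` is defined, non-degenerate and different from the base
point. -/
structure IsGood (s a n i : ℕ) (f : ℕ → ℕ) : Prop extends IsWord s n i f where
  pos : ∀ j ≤ n, 0 < f j
  lt : ∀ j ≤ n, f j < a

/-- The word given by a function on `ℕ`. -/
def IsWord.word {s n i : ℕ} {f : ℕ → ℕ} (h : IsWord s n i f) : Word s n where
  k j := f j
  i := i
  one_le_i := h.one_le
  i_le := h.le
  sum_k := (Finset.sum_range f).symm.trans h.sum_eq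

/-- The class of the word `x^{i-1} x₀ x^{f 0 - i} | x^{f 1} | ⋯ | x^{f n}` in the reduced normalized
chains, with the value `0` if there is no such word. -/
noncomputable def gen (s a n i : ℕ) (f : ℕ → ℕ) : Chains (X s a) (pt s a) n :=
  open Classical in if h : IsWord s n i f then wcls a h.word else 0

variable {s a n i : ℕ} {f g : ℕ → ℕ}

theorem gen_of_isWord (h : IsWord s n i f) : gen s a n i f = wcls a h.word := by
  rw [gen, dif_pos h]

theorem gen_of_not_isWord (h : ¬ IsWord s n i f) : gen s a n i f = 0 := by
  rw [gen, dif_neg h]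

theorem wcls_eq_gen (w : Word s n) (hi : w.i = i) (hk : ∀ j : Fin (n + 1), w.k j = f j) :
    wcls a w = gen s a n i f := by
  have h : IsWord s n i f :=
    ⟨hi ▸ w.one_le_i, by have := hk 0; rw [Fin.val_zero] at this; rw [← hi, ← this]; exact w.i_le,
      by rw [Finset.sum_range, ← w.sum_k]; exact Finset.sum_congr rfl fun j _ => (hk j).symm⟩
  rw [gen_of_isWord h]
  congr 1
  ext j
  · exact hk j
  · exact hi

theorem gen_congr {i' : ℕ} (hi : i = i') (h : ∀ j ≤ n, f j = g j) :
    gen s a n i f = gen s a n i' g := by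
  subst hi
  by_cases hf : IsWord s n i f
  · rw [gen_of_isWord hf]
    exact wcls_eq_gen _ rfl fun j => h j (Nat.lt_succ_iff.1 j.isLt)
  · rw [gen_of_not_isWord hf, gen_of_not_isWord]
    rintro ⟨h1, h2, h3⟩
    refine hf ⟨h1, by rw [h 0 (Nat.zero_le _)]; exact h2, ?_⟩
    rw [← h3]
    exact Finset.sum_congr rfl fun j hj => h j (Nat.lt_succ_iff.1 (Finset.mem_range.1 hj))

theorem gen_eq_zero_of_le {j : ℕ} (hj : j ≤ n) (h : a ≤ f j) : gen s a n i f = 0 := by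
  by_cases hf : IsWord s n i f
  · rw [gen_of_isWord hf]
    exact wcls_of_not_short fun hs => (hs ⟨j, Nat.lt_succ_iff.2 hj⟩).not_ge h
  · exact gen_of_not_isWord hf

theorem gen_eq_zero_of_eq_zero {j : ℕ} (hj : j ≤ n) (h : f j = 0) : gen s a n i f = 0 := by
  by_cases hf : IsWord s n i f
  · rw [gen_of_isWord hf]
    exact wcls_of_k_eq_zero (l := ⟨j, Nat.lt_succ_iff.2 hj⟩) h
  · exact gen_of_not_isWord hf

theorem gen_of_not_isGood (h : ¬ IsGood s a n i f) : gen s a n i f = 0 := by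
  by_cases hf : IsWord s n i f
  · by_cases hp : ∀ j ≤ n, 0 < f j
    · have : ¬ ∀ j ≤ n, f j < a := fun hl => h ⟨hf, hp, hl⟩
      push Not at this
      obtain ⟨j, hj, hl⟩ := this
      exact gen_eq_zero_of_le hj hl
    · push Not at hp
      obtain ⟨j, hj, hl⟩ := hp
      exact gen_eq_zero_of_eq_zero hj (Nat.le_zero.1 hl)
  · exact gen_of_not_isWord hf

/-- The slot degrees of a word as a function on `ℕ`, extended by zero. -/
def Word.fn (w : Word s n) (j : ℕ) : ℕ := if h : j < n + 1 then w.k ⟨j, h⟩ else 0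

theorem Word.fn_val (w : Word s n) (j : Fin (n + 1)) : w.fn j = w.k j := by
  exact dif_pos j.isLt

theorem gen_fn (w : Word s n) : gen s a n w.i w.fn = wcls a w :=
  (wcls_eq_gen w rfl fun j => (w.fn_val j).symm).symm

theorem Word.isWord_fn (w : Word s n) : IsWord s n w.i w.fn :=
  ⟨w.one_le_i, w.i_le.trans_eq (w.fn_val 0).symm, by
    rw [Finset.sum_range]
    exact (Finset.sum_congr rfl fun j _ => w.fn_val j).trans w.sum_k⟩

/-- Linear maps out of the chains agree if they agree on the non-degenerate words. -/
theorem chains_ext_gen {M : Type} [AddCommGroup M]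
    {u v : Chains (X s a) (pt s a) n →ₗ[ℤ] M}
    (h : ∀ i f, IsGood s a n i f → u (gen s a n i f) = v (gen s a n i f)) : u = v := by
  refine chains_ext fun w hs hp => ?_
  rw [← gen_fn]
  refine h _ _ ⟨w.isWord_fn, fun j hj => ?_, fun j hj => ?_⟩
  · rw [w.fn_val ⟨j, Nat.lt_succ_iff.2 hj⟩]; exact hp _
  · rw [w.fn_val ⟨j, Nat.lt_succ_iff.2 hj⟩]; exact hs _

theorem chains_eq_top {p : Submodule ℤ (Chains (X s a) (pt s a) n)}
    (h : ∀ i f, IsGood s a n i f → gen s a n i f ∈ p) : p = ⊤ := by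
  rw [← Submodule.ker_mkQ p, LinearMap.ker_eq_top]
  refine chains_ext_gen fun i f hf => ?_
  rw [LinearMap.zero_apply]
  exact (Submodule.Quotient.mk_eq_zero _).2 (h i f hf)

section lift

variable {M : Type} [AddCommGroup M]

/-- The linear map on chains with prescribed values `F i f` on the non-degenerate words. -/
noncomputable def genLift (F : ℕ → (ℕ → ℕ) → M) : Chains (X s a) (pt s a) n →ₗ[ℤ] M :=
  liftChains (X s a) (pt s a)
    (fun x : Simplex s a n =>
      x.elim 0 fun w => open Classical in if ∀ l, 0 < w.1.k l then F w.1.i w.1.fn else 0)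
    (fun (x : Simplex s a n) hx => by
      cases x with
      | none => rfl
      | some w =>
        have h1 : some w = Simplex.ofWord a w.1 := by simp [Simplex.ofWord, w.2]
        rw [h1] at hx
        obtain ⟨l, hl⟩ := exists_k_eq_zero_of_degenerate w.2 hx
        refine if_neg fun h => ?_
        exact (h l).ne' hl)
    rfl

theorem genLift_gen {F : ℕ → (ℕ → ℕ) → M}
    (hF : ∀ i f g, (∀ j ≤ n, f j = g j) → F i f = F i g) (h : IsGood s a n i f) :
    genLift F (gen s a n i f) = F i f := by
  rw [gen_of_isWord h.toIsWord]
  have hs : h.word.Short a := fun j => h.lt j (Nat.lt_succ_iff.1 j.isLt)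
  have hp : ∀ l, 0 < h.word.k l := fun j => h.pos j (Nat.lt_succ_iff.1 j.isLt)
  refine (liftChains_cls _ _ _ _ _ _).trans ?_
  simp only [Simplex.ofWord, hs, dif_pos, Option.elim]
  rw [if_pos hp]
  refine hF _ _ _ fun j hj => ?_
  exact h.word.fn_val ⟨j, Nat.lt_succ_iff.2 hj⟩

end lift

/-- Multiply the slots `c` and `c + 1`. -/
def mergeAt (c : ℕ) (f : ℕ → ℕ) (j : ℕ) : ℕ :=
  if j < c then f j else if j = c then f c + f (c + 1) else f (j + 1)

/-- Multiply a word of degree `e` onto the slot `0`. -/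
def addZero (e : ℕ) (f : ℕ → ℕ) (j : ℕ) : ℕ := if j = 0 then f 0 + e else f j

/-- Move the slot `n` to the front. -/
def cycle (n : ℕ) (f : ℕ → ℕ) (j : ℕ) : ℕ := if j = 0 then f n else f (j - 1)

theorem map_dOp_castSucc_k (w : Word s (n + 1)) (c j : Fin (n + 1)) :
    (w.map (dOp c.castSucc)).k j = mergeAt c w.fn j := by
  change ∑ l with slot (dOp c.castSucc) l = j, w.k l = _
  have hc := c.isLt
  have hj := j.isLt
  have hset : ∀ t : Finset (Fin (n + 2)), (∀ l, l ∈ t ↔ slot (dOp c.castSucc) l = j) →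
      ∑ l with slot (dOp c.castSucc) l = j, w.k l = ∑ l ∈ t, w.k l := fun t ht =>
    Finset.sum_congr (by ext l; simp [ht]) fun _ _ => rfl
  simp only [Fin.ext_iff, slot_δ, Fin.val_castSucc] at hset
  simp only [mergeAt]
  split_ifs with h1 h2
  · simp only [Fin.ext_iff, slot_δ, Fin.val_castSucc]
    rw [hset {j.castSucc}, Finset.sum_singleton, ← w.fn_val, Fin.val_castSucc]
    intro l
    have := l.isLt
    simp only [Finset.mem_singleton, Fin.ext_iff, Fin.val_castSucc]
    split_ifs <;> omega
  · simp only [Fin.ext_iff, slot_δ, Fin.val_castSucc]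
    rw [hset {c.castSucc, c.succ}, Finset.sum_pair (by simp [Fin.ext_iff]), ← w.fn_val,
      ← w.fn_val, Fin.val_castSucc, Fin.val_succ]
    intro l
    have := l.isLt
    simp only [Finset.mem_singleton, Finset.mem_insert, Fin.ext_iff, Fin.val_castSucc,
      Fin.val_succ]
    split_ifs <;> omega
  · simp only [Fin.ext_iff, slot_δ, Fin.val_castSucc]
    rw [hset {j.succ}, Finset.sum_singleton, ← w.fn_val, Fin.val_succ]
    intro l
    have := l.isLt
    simp only [Finset.mem_singleton, Fin.ext_iff, Fin.val_succ]
    split_ifs <;> omega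

theorem map_dOp_last_k (w : Word s (n + 1)) (j : Fin (n + 1)) :
    (w.map (dOp (Fin.last (n + 1)))).k j = addZero (w.fn (n + 1)) w.fn j := by
  change ∑ l with slot (dOp (Fin.last (n + 1))) l = j, w.k l = _
  have hj := j.isLt
  have hset : ∀ t : Finset (Fin (n + 2)), (∀ l, l ∈ t ↔ slot (dOp (Fin.last (n + 1))) l = j) →
      ∑ l with slot (dOp (Fin.last (n + 1))) l = j, w.k l = ∑ l ∈ t, w.k l := fun t ht =>
    Finset.sum_congr (by ext l; simp [ht]) fun _ _ => rfl
  simp only [Fin.ext_iff, slot_δ, Fin.val_last] at hset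
  simp only [addZero]
  split_ifs with h1
  · simp only [Fin.ext_iff, slot_δ, Fin.val_last]
    rw [hset {0, Fin.last (n + 1)}, Finset.sum_pair (by simp [Fin.ext_iff]), ← w.fn_val,
      ← w.fn_val, Fin.val_last, Fin.val_zero]
    intro l
    have := l.isLt
    simp only [Finset.mem_singleton, Finset.mem_insert, Fin.ext_iff, Fin.val_last, Fin.val_zero]
    split_ifs <;> omega
  · simp only [Fin.ext_iff, slot_δ, Fin.val_last]
    rw [hset {j.castSucc}, Finset.sum_singleton, ← w.fn_val, Fin.val_castSucc]
    intro l
    have := l.isLt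
    simp only [Finset.mem_singleton, Fin.ext_iff, Fin.val_castSucc]
    split_ifs <;> omega

/-- The Hochschild boundary in terms of slot degrees. -/
theorem boundary_gen (h : IsWord s (n + 1) i f) :
    boundary (X s a) (pt s a) n (gen s a (n + 1) i f) =
      ∑ c ∈ Finset.range (n + 1), (-1 : ℤ) ^ c • gen s a n i (mergeAt c f) +
        (-1 : ℤ) ^ (n + 1) • gen s a n (i + f (n + 1)) (addZero (f (n + 1)) f) := by
  have hfn : ∀ j ≤ n + 1, h.word.fn j = f j := fun j hj =>
    h.word.fn_val ⟨j, Nat.lt_succ_iff.2 hj⟩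
  rw [gen_of_isWord h, boundary_wcls, Fin.sum_univ_castSucc, Finset.sum_range]
  congr 1
  · refine Finset.sum_congr rfl fun c _ => ?_
    rw [Fin.val_castSucc]
    congr 1
    have hc := c.isLt
    refine wcls_eq_gen _ ?_ fun j => ?_
    · rw [Word.map_δ_i, if_neg (by rw [Fin.val_castSucc]; omega), add_zero]
      rfl
    · have hj := j.isLt
      rw [map_dOp_castSucc_k]
      simp only [mergeAt]
      split_ifs
      · rw [hfn _ (by omega)]
      · rw [hfn _ (by omega), hfn _ (by omega)]
      · rw [hfn _ (by omega)]
  · rw [Fin.val_last]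
    congr 1
    refine wcls_eq_gen _ ?_ fun j => ?_
    · rw [Word.map_δ_i, if_pos (Fin.val_last _)]
      rfl
    · have hj := j.isLt
      rw [map_dOp_last_k]
      simp only [addZero]
      rw [hfn _ le_rfl, hfn _ (by omega), hfn _ (by omega)]

theorem rot_gen_of_one_lt (h : IsWord s n i f) (hi : 1 < i) :
    rot s a n (gen s a n i f) = gen s a n (i - 1) f := by
  rw [gen_of_isWord h, rot_wcls, rotWord, dif_pos (show 1 < h.word.i from hi)]
  exact wcls_eq_gen _ rfl fun j => rfl

theorem rot_gen_one (h : IsWord s n 1 f) (hn : 0 < f n) :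
    rot s a n (gen s a n 1 f) = (-1 : ℤ) ^ n • gen s a n (f n) (cycle n f) := by
  rw [gen_of_isWord h, rot_wcls, rotWord, dif_neg (show ¬ 1 < h.word.i from lt_irrefl 1),
    dif_pos (show 0 < h.word.k (Fin.last n) from hn)]
  congr 1
  refine wcls_eq_gen _ rfl fun j => ?_
  change f ((j - 1 : Fin (n + 1)) : ℕ) = _
  rw [cycle]
  split_ifs with h0
  · have h : (0 - 1 : Fin (n + 1)) = Fin.last n := by
      rw [sub_eq_iff_eq_add, Fin.last_add_one]
    have h0' : j = 0 := Fin.ext h0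
    rw [h0', h, Fin.val_last]
  · congr 1
    rw [Fin.val_sub_one_of_ne_zero]
    exact fun h => h0 (by rw [h, Fin.val_zero])

/-! ### A homotopy splitting the last slot -/

theorem IsWord.congr (h : IsWord s n i f) (hfg : ∀ j ≤ n, f j = g j) : IsWord s n i g :=
  ⟨h.one_le, hfg 0 (Nat.zero_le _) ▸ h.le, by
    rw [← h.sum_eq]
    exact Finset.sum_congr rfl fun j hj => (hfg j (Nat.lt_succ_iff.1 (Finset.mem_range.1 hj))).symm⟩

theorem IsWord.mergeAt {c : ℕ} (h : IsWord s (n + 1) i f) (hc : c ≤ n) :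
    IsWord s n i (mergeAt c f) := by
  refine ⟨h.one_le, ?_, ?_⟩
  · rw [TruncatedBar.mergeAt]
    have := h.le
    split_ifs with h1 h2
    · exact this
    · subst h2; omega
    · omega
  · rw [← h.sum_eq]
    obtain ⟨d, rfl⟩ := Nat.exists_eq_add_of_le hc
    rw [show c + d + 1 + 1 = (c + 1 + 1) + d by ring, show c + d + 1 = (c + 1) + d by ring,
      Finset.sum_range_add, Finset.sum_range_add _ (c + 1 + 1), Finset.sum_range_succ,
      Finset.sum_range_succ, Finset.sum_range_succ]
    have h1 : ∑ x ∈ Finset.range c, TruncatedBar.mergeAt c f x = ∑ x ∈ Finset.range c, f x :=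
      Finset.sum_congr rfl fun x hx => if_pos (Finset.mem_range.1 hx)
    have h2 : ∑ x ∈ Finset.range d, TruncatedBar.mergeAt c f (c + 1 + x) =
        ∑ x ∈ Finset.range d, f (c + 1 + 1 + x) := by
      refine Finset.sum_congr rfl fun x _ => ?_
      rw [TruncatedBar.mergeAt, if_neg (by omega), if_neg (by omega)]
      congr 1
      omega
    have h3 : TruncatedBar.mergeAt c f c = f c + f (c + 1) := by simp [TruncatedBar.mergeAt]
    rw [h1, h2, h3]
    ring

theorem sum_addZero (e n : ℕ) (f : ℕ → ℕ) :
    ∑ j ∈ Finset.range (n + 1), addZero e f j = ∑ j ∈ Finset.range (n + 1), f j + e := by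
  rw [Finset.sum_range_succ', Finset.sum_range_succ']
  simp [addZero]
  ring

/-- Multiplying `x^e` onto the slot `0` from the left, at the cost of the total degree. -/
theorem IsWord.addZero {e : ℕ} (h : IsWord s n i f) :
    IsWord (s + e) n (i + e) (addZero e f) := by
  refine ⟨h.one_le.trans (Nat.le_add_right _ _), ?_, ?_⟩
  · have := h.le
    simp [TruncatedBar.addZero, this]
  · rw [sum_addZero, h.sum_eq]

/-- Split the slot `n`, which is meant to be the last one, as `x^{f n - 1} | x`. -/
def splitLast (n : ℕ) (f : ℕ → ℕ) (j : ℕ) : ℕ := if j < n then f j else if j = n then f n - 1 else 1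

theorem IsWord.splitLast (h : IsWord s (n + 1) i f) (hn : 0 < f (n + 1)) :
    IsWord s (n + 1 + 1) i (splitLast (n + 1) f) := by
  refine ⟨h.one_le, h.le.trans_eq (by simp [TruncatedBar.splitLast]), ?_⟩
  rw [← h.sum_eq, Finset.sum_range_succ, Finset.sum_range_succ, Finset.sum_range_succ _ (n + 1)]
  have h1 : ∑ x ∈ Finset.range (n + 1), TruncatedBar.splitLast (n + 1) f x =
      ∑ x ∈ Finset.range (n + 1), f x :=
    Finset.sum_congr rfl fun x hx => if_pos (Finset.mem_range.1 hx)
  rw [h1]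
  simp [TruncatedBar.splitLast]
  omega

/-- The contracting homotopy up to higher position of `x₀`: it splits off the letter `x` from the
last slot. -/
noncomputable def homot (s a n : ℕ) :
    Chains (X s a) (pt s a) n →ₗ[ℤ] Chains (X s a) (pt s a) (n + 1) :=
  genLift fun i f => (-1 : ℤ) ^ n • gen s a (n + 1) i (splitLast n f)

theorem splitLast_congr (h : ∀ j ≤ n, f j = g j) (j : ℕ) : splitLast n f j = splitLast n g j := by
  simp only [splitLast]
  split_ifs with h1
  · exact h j h1.le
  · rw [h n le_rfl]
  · rfl

theorem homot_gen_of_isGood (h : IsGood s a n i f) :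
    homot s a n (gen s a n i f) = (-1 : ℤ) ^ n • gen s a (n + 1) i (splitLast n f) :=
  genLift_gen (fun i f g hfg => by
    rw [gen_congr rfl fun j _ => splitLast_congr hfg j]) h

theorem homot_gen (h : IsWord s n i f) (hp : ∀ j ≤ n, 0 < f j) (ha : f n ≠ a) :
    homot s a n (gen s a n i f) = (-1 : ℤ) ^ n • gen s a (n + 1) i (splitLast n f) := by
  by_cases hl : ∀ j ≤ n, f j < a
  · exact homot_gen_of_isGood ⟨h, hp, hl⟩
  · push Not at hl
    obtain ⟨j, hj, hl⟩ := hl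
    rw [gen_eq_zero_of_le hj hl, map_zero, gen_eq_zero_of_le (j := j), smul_zero]
    · omega
    · rw [splitLast]
      split_ifs
      · exact hl
      · have : j = n := by omega
        subst this
        omega
      · omega

/-- The chains spanned by the words in which `x₀` is at a position at least `p`. -/
noncomputable def posFil (s a n p : ℕ) : Submodule ℤ (Chains (X s a) (pt s a) n) :=
  Submodule.span ℤ {x | ∃ i f, p ≤ i ∧ gen s a n i f = x}

theorem gen_mem_posFil {p : ℕ} (h : p ≤ i) : gen s a n i f ∈ posFil s a n p :=
  Submodule.subset_span ⟨i, f, h, rfl⟩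

theorem posFil_anti {p q : ℕ} (h : p ≤ q) : posFil s a n q ≤ posFil s a n p :=
  Submodule.span_mono fun _ ⟨i, f, hi, hx⟩ => ⟨i, f, h.trans hi, hx⟩

theorem posFil_zero : posFil s a n 0 = ⊤ :=
  chains_eq_top fun _ _ _ => gen_mem_posFil (Nat.zero_le _)

theorem posFil_eq_bot : posFil s a n a = ⊥ := by
  rw [posFil, Submodule.span_eq_bot]
  rintro _ ⟨i, f, hi, rfl⟩
  refine gen_of_not_isGood fun h => ?_
  have h1 := h.le
  have h2 := h.lt 0 (Nat.zero_le _)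
  omega

theorem homot_gen_mem_posFil : homot s a n (gen s a n i f) ∈ posFil s a (n + 1) i := by
  by_cases h : IsGood s a n i f
  · rw [homot_gen_of_isGood h]
    exact Submodule.smul_mem _ _ (gen_mem_posFil le_rfl)
  · rw [gen_of_not_isGood h, map_zero]
    exact Submodule.zero_mem _

/-- The cycles of the reduced normalized chain complex. -/
noncomputable def cycles (s a n : ℕ) : Submodule ℤ (Chains (X s a) (pt s a) n) :=
  match n with
  | 0 => ⊤
  | n + 1 => LinearMap.ker (boundary (X s a) (pt s a) n)

theorem boundary_boundary_apply (z : Chains (X s a) (pt s a) (n + 1 + 1)) :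
    boundary (X s a) (pt s a) n (boundary (X s a) (pt s a) (n + 1) z) = 0 :=
  LinearMap.congr_fun (boundary_boundary (X s a) (pt s a) n) z

theorem boundary_mem_cycles (z : Chains (X s a) (pt s a) (n + 1)) :
    boundary (X s a) (pt s a) n z ∈ cycles s a n := by
  cases n with
  | zero => exact Submodule.mem_top
  | succ n => exact boundary_boundary_apply z

/-- The defect `1 - ∂h - h∂` of the homotopy, which is `1 - ∂h` in degree `0`. -/
noncomputable def defect (s a n : ℕ) :
    Chains (X s a) (pt s a) n →ₗ[ℤ] Chains (X s a) (pt s a) n :=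
  match n with
  | 0 => LinearMap.id - boundary (X s a) (pt s a) 0 ∘ₗ homot s a 0
  | n + 1 => LinearMap.id - boundary (X s a) (pt s a) (n + 1) ∘ₗ homot s a (n + 1) -
      homot s a n ∘ₗ boundary (X s a) (pt s a) n

theorem defect_of_mem_cycles {z : Chains (X s a) (pt s a) n} (hz : z ∈ cycles s a n) :
    defect s a n z = z - boundary (X s a) (pt s a) n (homot s a n z) := by
  cases n with
  | zero => rfl
  | succ n =>
    have h : boundary (X s a) (pt s a) n z = 0 := hz
    simp [defect, h]

/-- If the defect of the homotopy agrees with `P` up to higher positions of `x₀`, then a cycle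
killed by `P` is a boundary: subtracting boundaries of the form `∂hz` moves it to higher and higher
positions, and the position is less than `a`. -/
theorem mem_range_boundary_of_defect
    (P : Chains (X s a) (pt s a) n →ₗ[ℤ] Chains (X s a) (pt s a) n)
    (hP : ∀ i f, IsGood s a n i f →
      defect s a n (gen s a n i f) - P (gen s a n i f) ∈ posFil s a n (i + 1))
    (hPh : ∀ y, P (boundary (X s a) (pt s a) n (homot s a n y)) = 0)
    {z : Chains (X s a) (pt s a) n} (hz : z ∈ cycles s a n) (hPz : P z = 0) :
    z ∈ LinearMap.range (boundary (X s a) (pt s a) n) := by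
  have key : ∀ p z, z ∈ posFil s a n p → (defect s a n - P) z ∈ posFil s a n (p + 1) := by
    intro p z hz
    have : posFil s a n p ≤ (posFil s a n (p + 1)).comap (defect s a n - P) := by
      refine Submodule.span_le.2 ?_
      rintro _ ⟨i, f, hi, rfl⟩
      change _ ∈ posFil s a n (p + 1)
      by_cases h : IsGood s a n i f
      · exact posFil_anti (by omega) (hP i f h)
      · rw [gen_of_not_isGood h, map_zero]
        exact Submodule.zero_mem _
    exact this hz
  have main : ∀ k p, p + k = a → ∀ z ∈ posFil s a n p, z ∈ cycles s a n → P z = 0 →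
      z ∈ LinearMap.range (boundary (X s a) (pt s a) n) := by
    intro k
    induction k with
    | zero =>
      intro p hp z hz _ _
      rw [show p = a from hp, posFil_eq_bot, Submodule.mem_bot] at hz
      rw [hz]
      exact Submodule.zero_mem _
    | succ k ih =>
      intro p hp z hz hc hPz
      have h1 := key p z hz
      rw [LinearMap.sub_apply, hPz, sub_zero, defect_of_mem_cycles hc] at h1
      have h2 := ih (p + 1) (by omega) _ h1 (Submodule.sub_mem _ hc (boundary_mem_cycles _))
        (by rw [map_sub, hPz, hPh, sub_zero])
      have h3 := Submodule.add_mem _ h2 (LinearMap.mem_range_self _ (homot s a n z))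
      rwa [sub_add_cancel] at h3
  exact main a 0 (zero_add a) z (posFil_zero ▸ Submodule.mem_top) hz hPz

/-- The slots `0, …, m - 1` followed by the slots `x^u | x^v`. -/
def appendTwo (m u v : ℕ) (f : ℕ → ℕ) (j : ℕ) : ℕ := if j < m then f j else if j = m then u else v

theorem IsGood.mergeAt_pos {c : ℕ} (h : IsGood s a (n + 1) i f) : ∀ j ≤ n, 0 < mergeAt c f j := by
  intro j hj
  have h1 := h.pos j (by omega)
  have h2 := h.pos (j + 1) (by omega)
  rw [mergeAt]
  split_ifs with h3 h4
  · exact h1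
  · subst h4; omega
  · exact h2

/-- Up to higher positions of `x₀`, the only obstruction to contracting a word in positive
degree is that the last two slots multiply to `x^a`. -/
theorem defect_gen_succ {m : ℕ} (h : IsGood s a (m + 1) i f) :
    defect s a (m + 1) (gen s a (m + 1) i f) -
      (if f m + f (m + 1) = a then gen s a (m + 1) i (appendTwo m (a - 1) 1 f) else 0) ∈
        posFil s a (m + 1) (i + 1) := by
  have hm := h.pos m (by omega)
  have hm' := h.pos (m + 1) le_rfl
  have hl' := h.lt (m + 1) le_rfl
  set A := ∑ c ∈ Finset.range m, (-1 : ℤ) ^ c •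
    gen s a (m + 1) i (mergeAt c (splitLast (m + 1) f)) with hA
  set B := gen s a (m + 1) i (mergeAt m (splitLast (m + 1) f)) with hB
  set N := gen s a (m + 1) (i + 1) (addZero 1 (splitLast (m + 1) f)) with hN
  set E := homot s a m (gen s a m (i + f (m + 1)) (addZero (f (m + 1)) f)) with hE
  have h1 : boundary (X s a) (pt s a) (m + 1) (homot s a (m + 1) (gen s a (m + 1) i f)) =
      (-1 : ℤ) ^ (m + 1) • (A + (-1 : ℤ) ^ m • B + (-1 : ℤ) ^ (m + 1) • gen s a (m + 1) i f +
        (-1 : ℤ) ^ (m + 2) • N) := by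
    rw [homot_gen_of_isGood h, map_smul]
    congr 1
    rw [boundary_gen (h.toIsWord.splitLast hm'), Finset.sum_range_succ, Finset.sum_range_succ]
    congr 1
    · congr 2
      refine gen_congr rfl fun j hj => ?_
      simp only [mergeAt, splitLast]
      split_ifs <;> first | omega | skip
      have : j = m + 1 := by omega
      subst this
      omega
    · simp only [splitLast]
      simp only [if_false, Nat.succ_ne_self, Nat.not_succ_lt_self]
      rfl
  have h2 : homot s a m (boundary (X s a) (pt s a) m (gen s a (m + 1) i f)) =
      (-1 : ℤ) ^ m • A + (-1 : ℤ) ^ m •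
        homot s a m (gen s a m i (mergeAt m f)) + (-1 : ℤ) ^ (m + 1) • E := by
    rw [boundary_gen h.toIsWord, Finset.sum_range_succ, map_add, map_add, map_smul, map_smul,
      map_sum, hA, Finset.smul_sum]
    congr 2
    refine Finset.sum_congr rfl fun c hc => ?_
    rw [Finset.mem_range] at hc
    rw [map_smul, homot_gen (h.toIsWord.mergeAt (by omega)) h.mergeAt_pos, smul_smul, smul_smul,
      mul_comm]
    · congr 1
      refine gen_congr rfl fun j hj => ?_
      simp only [mergeAt, splitLast]
      split_ifs <;> omega
    · rw [mergeAt, if_neg (by omega), if_neg (by omega)]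
      exact hl'.ne
  have h3 : homot s a m (gen s a m i (mergeAt m f)) =
      if f m + f (m + 1) = a then 0 else (-1 : ℤ) ^ m • B := by
    have hmm : mergeAt m f m = f m + f (m + 1) := by simp [mergeAt]
    split_ifs with ha
    · rw [gen_eq_zero_of_le le_rfl (hmm.trans ha).ge, map_zero]
    · rw [homot_gen (h.toIsWord.mergeAt le_rfl) h.mergeAt_pos (hmm ▸ ha)]
      congr 1
      refine gen_congr rfl fun j hj => ?_
      simp only [mergeAt, splitLast]
      split_ifs <;> omega
  have h4 : f m + f (m + 1) = a → gen s a (m + 1) i (appendTwo m (a - 1) 1 f) = B := by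
    intro ha
    refine gen_congr rfl fun j hj => ?_
    simp only [mergeAt, splitLast, appendTwo]
    split_ifs <;> omega
  have h5 : defect s a (m + 1) (gen s a (m + 1) i f) -
      (if f m + f (m + 1) = a then gen s a (m + 1) i (appendTwo m (a - 1) 1 f) else 0) =
        N - (-1 : ℤ) ^ (m + 1) • E := by
    simp only [defect, LinearMap.sub_apply, LinearMap.comp_apply, LinearMap.id_apply]
    rw [h1, h2, h3]
    split_ifs with ha
    · rw [h4 ha]
      rcases neg_one_pow_eq_or ℤ m with hs | hs <;> simp [pow_succ, hs] <;> abel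
    · rcases neg_one_pow_eq_or ℤ m with hs | hs <;> simp [pow_succ, hs] <;> abel
  rw [h5]
  refine Submodule.sub_mem _ (gen_mem_posFil le_rfl) (Submodule.smul_mem _ _ ?_)
  exact posFil_anti (by omega) homot_gen_mem_posFil

/-- In degree zero the obstruction is the word `x^{s-1} x₀`. -/
theorem defect_gen_zero (h : IsGood s a 0 i f) :
    defect s a 0 (gen s a 0 i f) - gen s a 0 s (fun _ => s) ∈ posFil s a 0 (i + 1) := by
  have hf : f 0 = s := by have := h.sum_eq; simpa using this
  have hi := h.le
  have hp := h.one_le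
  simp only [defect, LinearMap.sub_apply, LinearMap.comp_apply, LinearMap.id_apply]
  rw [homot_gen_of_isGood h, pow_zero, one_smul]
  rcases hi.lt_or_eq with hlt | heq
  · have hw : IsWord s 1 i (splitLast 0 f) := by
      refine ⟨hp, ?_, ?_⟩
      · simp [splitLast]; omega
      · simp [Finset.sum_range_succ, splitLast]; omega
    have h1 : gen s a 0 i (mergeAt 0 (splitLast 0 f)) = gen s a 0 i f :=
      gen_congr rfl fun j hj => by
        obtain rfl : j = 0 := by omega
        simp [mergeAt, splitLast]; omega
    rw [boundary_gen hw]
    simp only [zero_add, Finset.sum_range_one, pow_zero, one_smul, pow_one, h1, neg_smul]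
    rw [sub_add_cancel_left, neg_neg]
    refine Submodule.sub_mem _ (gen_mem_posFil ?_) (gen_mem_posFil (by omega))
    simp [splitLast]
  · rw [gen_of_not_isWord (f := splitLast 0 f), map_zero, sub_zero,
      gen_congr (g := fun _ => s) (heq.trans hf), sub_self]
    · exact Submodule.zero_mem _
    · intro j hj
      obtain rfl : j = 0 := by omega
      exact hf
    · intro hw
      have := hw.le
      simp [splitLast] at this
      omega

/-! ### Periodicity: removing and adding two slots of total degree `a` -/

theorem addZero_congr (e : ℕ) {j : ℕ} (h0 : f 0 = g 0) (hj : f j = g j) :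
    addZero e f j = addZero e g j := by
  simp only [addZero]
  rw [h0, hj]

theorem mergeAt_addZero (c e : ℕ) (f : ℕ → ℕ) (j : ℕ) :
    mergeAt c (addZero e f) j = addZero e (mergeAt c f) j := by
  rcases Nat.eq_zero_or_pos c with rfl | hc
  · rcases Nat.eq_zero_or_pos j with rfl | hj
    · simp [mergeAt, addZero]
      omega
    · simp [mergeAt, addZero, hj.ne']
  · rcases Nat.eq_zero_or_pos j with rfl | hj
    · simp [mergeAt, addZero, hc]
    · simp [mergeAt, addZero, hj.ne', hc.ne']

/-- Cap product with the two-dimensional class: the last two slots `x^u | x^v` with `u + v ≥ a` are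
removed, and `x^{u+v-a}` is multiplied onto the slot `0` from the left; other words go to `0`. -/
noncomputable def cap (s a n : ℕ) :
    Chains (X (s + a) a) (pt (s + a) a) (n + 2) →ₗ[ℤ] Chains (X s a) (pt s a) n :=
  genLift fun i f => if a ≤ f (n + 1) + f (n + 2) then
    gen s a n (i + (f (n + 1) + f (n + 2) - a)) (addZero (f (n + 1) + f (n + 2) - a) f) else 0

theorem cap_gen (h : IsWord (s + a) (n + 2) i f) (h1 : f (n + 1) < a) (h2 : f (n + 2) < a) :
    cap s a n (gen (s + a) a (n + 2) i f) = if a ≤ f (n + 1) + f (n + 2) then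
      gen s a n (i + (f (n + 1) + f (n + 2) - a)) (addZero (f (n + 1) + f (n + 2) - a) f)
      else 0 := by
  by_cases hg : IsGood (s + a) a (n + 2) i f
  · refine genLift_gen (fun i f g hfg => ?_) hg
    rw [hfg (n + 1) (by omega), hfg (n + 2) le_rfl]
    congr 1
    exact gen_congr rfl fun j hj => addZero_congr _ (hfg 0 (by omega)) (hfg j (by omega))
  · rw [gen_of_not_isGood hg, map_zero]
    split_ifs with h3
    · refine (gen_of_not_isGood fun hg' => hg ⟨h, fun j hj => ?_, fun j hj => ?_⟩).symm
      · rcases Nat.lt_or_ge n j with hj' | hj'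
        · rcases (show j = n + 1 ∨ j = n + 2 by omega) with rfl | rfl <;> omega
        · have := hg'.pos j hj'
          have h4 := h.one_le
          have h5 := h.le
          rw [addZero] at this
          split_ifs at this with h0
          · subst h0; omega
          · assumption
      · rcases Nat.lt_or_ge n j with hj' | hj'
        · rcases (show j = n + 1 ∨ j = n + 2 by omega) with rfl | rfl <;> omega
        · have := hg'.lt j hj'
          rw [addZero] at this
          split_ifs at this with h0
          · subst h0; omega
          · assumption
    · rfl

theorem cap_gen_eq_zero_left (h1 : a ≤ f (n + 1)) :
    cap s a n (gen (s + a) a (n + 2) i f) = 0 := by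
  rw [gen_eq_zero_of_le (by omega) h1, map_zero]

theorem cap_gen_eq_zero_right (h1 : a ≤ f (n + 2)) :
    cap s a n (gen (s + a) a (n + 2) i f) = 0 := by
  rw [gen_eq_zero_of_le le_rfl h1, map_zero]

theorem IsWord.cap {e : ℕ} (h : IsWord (s + a) (n + 2) i f)
    (he : f (n + 1) + f (n + 2) = a + e) : IsWord s n (i + e) (TruncatedBar.addZero e f) := by
  refine ⟨h.one_le.trans (Nat.le_add_right _ _), ?_, ?_⟩
  · have := h.le
    simp [TruncatedBar.addZero, this]
  · have := h.sum_eq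
    rw [Finset.sum_range_succ, Finset.sum_range_succ] at this
    rw [sum_addZero]
    omega

theorem IsWord.addZero_last (h : IsWord s (n + 1) i f) :
    IsWord s n (i + f (n + 1)) (TruncatedBar.addZero (f (n + 1)) f) := by
  refine ⟨h.one_le.trans (Nat.le_add_right _ _), ?_, ?_⟩
  · have := h.le
    simp [TruncatedBar.addZero, this]
  · rw [sum_addZero, ← h.sum_eq, Finset.sum_range_succ _ (n + 1)]

theorem IsWord.cycle (h : IsWord s n 1 f) (hn : 0 < f n) :
    IsWord s n (f n) (TruncatedBar.cycle n f) := by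
  refine ⟨hn, le_of_eq (by simp [TruncatedBar.cycle]), ?_⟩
  rw [Finset.sum_range_succ', ← h.sum_eq, Finset.sum_range_succ]
  simp [TruncatedBar.cycle]

theorem cap_boundary (z : Chains (X (s + a) a) (pt (s + a) a) (n + 1 + 2)) :
    cap s a n (boundary (X (s + a) a) (pt (s + a) a) (n + 2) z) =
      boundary (X s a) (pt s a) n (cap s a (n + 1) z) := by
  suffices h : cap s a n ∘ₗ boundary (X (s + a) a) (pt (s + a) a) (n + 2) =
      boundary (X s a) (pt s a) n ∘ₗ cap s a (n + 1) from LinearMap.congr_fun h z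
  refine chains_ext_gen fun i f h => ?_
  have p1 := h.pos (n + 1) (by omega)
  have p3 := h.pos (n + 3) (by omega)
  have l1 := h.lt (n + 1) (by omega)
  have l2 := h.lt (n + 2) (by omega)
  have l3 := h.lt (n + 3) (by omega)
  -- the word into which all three last slots are absorbed
  set t := f (n + 1) + f (n + 2) + f (n + 3) with ht
  set W := gen s a n (i + (t - a)) (addZero (t - a) f) with hW
  have e1 : cap s a n (gen (s + a) a (n + 2) i (mergeAt (n + 1) f)) =
      if f (n + 1) + f (n + 2) < a ∧ a ≤ t then W else 0 := by
    have v1 : mergeAt (n + 1) f (n + 1) = f (n + 1) + f (n + 2) := by simp [mergeAt]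
    have v2 : mergeAt (n + 1) f (n + 2) = f (n + 3) := by simp [mergeAt]
    by_cases h1 : f (n + 1) + f (n + 2) < a
    · rw [cap_gen (h.toIsWord.mergeAt (by omega)) (v1 ▸ h1) (v2 ▸ l3), v1, v2]
      simp only [h1, true_and]
      congr 1
      refine gen_congr rfl fun j hj => ?_
      refine addZero_congr _ ?_ ?_ <;> exact if_pos (by omega)
    · rw [cap_gen_eq_zero_left (by omega), if_neg (by omega)]
  have e2 : cap s a n (gen (s + a) a (n + 2) i (mergeAt (n + 2) f)) =
      if f (n + 2) + f (n + 3) < a ∧ a ≤ t then W else 0 := by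
    have v1 : mergeAt (n + 2) f (n + 1) = f (n + 1) := by simp [mergeAt]
    have v2 : mergeAt (n + 2) f (n + 2) = f (n + 2) + f (n + 3) := by simp [mergeAt]
    by_cases h1 : f (n + 2) + f (n + 3) < a
    · rw [cap_gen (h.toIsWord.mergeAt (by omega)) (v1 ▸ l1) (v2 ▸ h1), v1, v2, ← add_assoc]
      simp only [h1, true_and]
      congr 1
      refine gen_congr rfl fun j hj => ?_
      refine addZero_congr _ ?_ ?_ <;> exact if_pos (by omega)
    · rw [cap_gen_eq_zero_right (by omega), if_neg (by omega)]
  have e3 : cap s a n (gen (s + a) a (n + 2) (i + f (n + 3)) (addZero (f (n + 3)) f)) =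
      if a ≤ f (n + 1) + f (n + 2) then W else 0 := by
    have v1 : addZero (f (n + 3)) f (n + 1) = f (n + 1) := by simp [addZero]
    have v2 : addZero (f (n + 3)) f (n + 2) = f (n + 2) := by simp [addZero]
    have v3 : f (n + 2 + 1) = f (n + 3) := rfl
    rw [cap_gen h.toIsWord.addZero_last (v1 ▸ l1) (v2 ▸ l2), v1, v2]
    split_ifs with h1
    · refine gen_congr (by omega) fun j hj => ?_
      simp only [addZero, if_true]
      split_ifs <;> omega
    · rfl
  have e4 : ∀ c ∈ Finset.range (n + 1), cap s a n (gen (s + a) a (n + 2) i (mergeAt c f)) =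
      if a ≤ f (n + 2) + f (n + 3) then gen s a n (i + (f (n + 2) + f (n + 3) - a))
        (mergeAt c (addZero (f (n + 2) + f (n + 3) - a) f)) else 0 := by
    intro c hc
    rw [Finset.mem_range] at hc
    have v1 : mergeAt c f (n + 1) = f (n + 2) := by
      rw [mergeAt, if_neg (by omega), if_neg (by omega)]
    have v2 : mergeAt c f (n + 2) = f (n + 3) := by
      rw [mergeAt, if_neg (by omega), if_neg (by omega)]
    rw [cap_gen (h.toIsWord.mergeAt (by omega)) (v1 ▸ l2) (v2 ▸ l3), v1, v2]
    congr 1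
    exact gen_congr rfl fun j _ => (mergeAt_addZero _ _ _ _).symm
  rw [LinearMap.comp_apply, LinearMap.comp_apply, boundary_gen h.toIsWord, map_add, map_smul,
    map_sum, Finset.sum_range_succ, Finset.sum_range_succ]
  simp only [map_smul]
  rw [e1, e2, e3, Finset.sum_congr rfl fun c hc => by rw [e4 c hc], cap_gen h.toIsWord l2 l3]
  by_cases h23 : a ≤ f (n + 2) + f (n + 3)
  · have ha : a ≤ t := by omega
    have hw : IsWord s (n + 1) (i + (f (n + 2) + f (n + 3) - a))
        (addZero (f (n + 2) + f (n + 3) - a) f) :=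
      h.toIsWord.cap (show f (n + 2) + f (n + 3) = _ by omega)
    have e5 : gen s a n (i + (f (n + 2) + f (n + 3) - a) +
        addZero (f (n + 2) + f (n + 3) - a) f (n + 1))
        (addZero (addZero (f (n + 2) + f (n + 3) - a) f (n + 1))
          (addZero (f (n + 2) + f (n + 3) - a) f)) = W := by
      have v1 : addZero (f (n + 2) + f (n + 3) - a) f (n + 1) = f (n + 1) := by simp [addZero]
      rw [v1]
      refine gen_congr (by omega) fun j hj => ?_
      simp only [addZero, if_true]
      split_ifs <;> omega
    simp only [h23, if_true, ha, and_true, not_lt.2 h23, if_false, smul_zero, add_zero]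
    rw [boundary_gen hw, e5, add_assoc]
    congr 1
    by_cases h12 : a ≤ f (n + 1) + f (n + 2)
    · rw [if_neg (by omega), if_pos h12]
      simp [pow_succ]
    · rw [if_pos (by omega), if_neg h12]
      simp
  · have h23' : f (n + 2) + f (n + 3) < a := not_le.1 h23
    simp only [h23, if_false, smul_zero, Finset.sum_const_zero, zero_add, map_zero, h23', true_and]
    by_cases ha : a ≤ t
    · by_cases h12 : a ≤ f (n + 1) + f (n + 2)
      · rw [if_neg (by omega), if_pos ha, if_pos h12]
        simp [pow_succ]
      · rw [if_pos (by omega), if_pos ha, if_neg h12]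
        simp [pow_succ]
    · rw [if_neg (by omega), if_neg ha, if_neg (by omega)]
      simp

/-- The section `w ↦ w | x^{a-1} | x` of the cap product. It is not a chain map. -/
noncomputable def capSection (s a n : ℕ) :
    Chains (X s a) (pt s a) n →ₗ[ℤ] Chains (X (s + a) a) (pt (s + a) a) (n + 2) :=
  genLift fun i f => gen (s + a) a (n + 2) i (appendTwo (n + 1) (a - 1) 1 f)

theorem capSection_gen (h : IsGood s a n i f) : capSection s a n (gen s a n i f) =
    gen (s + a) a (n + 2) i (appendTwo (n + 1) (a - 1) 1 f) :=
  genLift_gen (fun i f g hfg => gen_congr rfl fun j hj => by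
    simp only [appendTwo]
    split_ifs with h1
    · exact hfg j (by omega)
    · rfl
    · rfl) h

theorem capSection_gen_mem : capSection s a n (gen s a n i f) ∈ posFil (s + a) a (n + 2) i := by
  by_cases h : IsGood s a n i f
  · rw [capSection_gen h]
    exact gen_mem_posFil le_rfl
  · rw [gen_of_not_isGood h, map_zero]
    exact Submodule.zero_mem _

/-- A cycle killed by the cap product is a boundary. -/
theorem mem_range_boundary_of_cap_eq_zero {z : Chains (X (s + a) a) (pt (s + a) a) (n + 2)}
    (hz : z ∈ cycles (s + a) a (n + 2)) (hc : cap s a n z = 0) :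
    z ∈ LinearMap.range (boundary (X (s + a) a) (pt (s + a) a) (n + 2)) := by
  refine mem_range_boundary_of_defect (capSection s a n ∘ₗ cap s a n) (fun i f h => ?_)
    (fun y => ?_) hz (by rw [LinearMap.comp_apply, hc, map_zero])
  · have h1 := defect_gen_succ (m := n + 1) h
    have l1 := h.lt (n + 1) (by omega)
    have l2 := h.lt (n + 2) le_rfl
    rw [LinearMap.comp_apply, cap_gen h.toIsWord l1 l2]
    rw [← sub_add_sub_cancel]
    refine Submodule.add_mem _ h1 ?_
    change (if f (n + 1) + f (n + 2) = a then _ else _) - _ ∈ _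
    rcases lt_trichotomy (f (n + 1) + f (n + 2)) a with hlt | heq | hgt
    · rw [if_neg (by omega), if_neg (by omega), map_zero, sub_zero]
      exact Submodule.zero_mem _
    · have hg : IsGood s a n (i + 0) (addZero 0 f) := by
        refine ⟨h.toIsWord.cap heq, fun j hj => ?_, fun j hj => ?_⟩
        · have := h.pos j (by omega)
          rw [addZero]; split_ifs with h0
          · subst h0; omega
          · exact this
        · have := h.lt j (by omega)
          rw [addZero]; split_ifs with h0
          · subst h0; omega
          · exact this
      rw [if_pos heq, if_pos heq.ge, heq, Nat.sub_self, capSection_gen hg]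
      rw [gen_congr (add_zero i) (g := appendTwo (n + 1) (a - 1) 1 f), sub_self]
      · exact Submodule.zero_mem _
      · intro j hj
        simp only [appendTwo, addZero]
        split_ifs <;> simp_all
    · rw [if_neg (by omega), if_pos hgt.le, zero_sub]
      exact Submodule.neg_mem _ (posFil_anti (by omega) capSection_gen_mem)
  · -- the homotopy takes values in words ending in `x`, whose cap product vanishes
    have h0 : cap s a (n + 1) ∘ₗ homot (s + a) a (n + 2) = 0 := by
      refine chains_ext_gen fun i f h => ?_
      have p := h.pos (n + 2) le_rfl
      have l := h.lt (n + 2) le_rfl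
      have v1 : splitLast (n + 2) f (n + 2) = f (n + 2) - 1 := by simp [splitLast]
      have v2 : splitLast (n + 2) f (n + 1 + 2) = 1 := by simp [splitLast]
      rw [LinearMap.comp_apply, homot_gen_of_isGood h, map_smul, LinearMap.zero_apply,
        cap_gen (h.toIsWord.splitLast p) (by rw [v1]; omega) (by rw [v2]; omega), v1, v2,
        if_neg (by omega), smul_zero]
    rw [LinearMap.comp_apply, cap_boundary]
    rw [show cap s a (n + 1) (homot (s + a) a (n + 2) y) = 0 from LinearMap.congr_fun h0 y,
      map_zero, map_zero]

/-- The quasi-inverse of the cap product, which comes from the comparison of the periodic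
resolution of `ℤ[x]/x^a` with the bar resolution: it appends `x^k | x` and multiplies `x^{a-1-k}`
onto the slot `0`, summed over `k = a - 1 - p`. -/
noncomputable def cup (s a n : ℕ) :
    Chains (X s a) (pt s a) n →ₗ[ℤ] Chains (X (s + a) a) (pt (s + a) a) (n + 2) :=
  genLift fun i f => ∑ p ∈ Finset.range a,
    gen (s + a) a (n + 2) (i + p) (appendTwo (n + 1) (a - 1 - p) 1 (addZero p f))

theorem cup_gen (h : IsWord s n i f) : cup s a n (gen s a n i f) = ∑ p ∈ Finset.range a,
    gen (s + a) a (n + 2) (i + p) (appendTwo (n + 1) (a - 1 - p) 1 (addZero p f)) := by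
  by_cases hg : IsGood s a n i f
  · refine genLift_gen (fun i f g hfg => Finset.sum_congr rfl fun p _ => ?_) hg
    refine gen_congr rfl fun j hj => ?_
    simp only [appendTwo]
    split_ifs
    · exact addZero_congr p (hfg 0 (by omega)) (hfg j (by omega))
    · rfl
    · rfl
  · rw [gen_of_not_isGood hg, map_zero]
    refine (Finset.sum_eq_zero fun p _ => ?_).symm
    refine gen_of_not_isGood fun hg' => hg ⟨h, fun j hj => ?_, fun j hj => ?_⟩
    · have h1 := hg'.pos j (by omega)
      have := h.one_le
      have := h.le
      rw [appendTwo, if_pos (by omega), addZero] at h1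
      split_ifs at h1 with h0
      · subst h0; omega
      · exact h1
    · have h1 := hg'.lt j (by omega)
      rw [appendTwo, if_pos (by omega), addZero] at h1
      split_ifs at h1 with h0
      · subst h0; omega
      · exact h1

theorem IsWord.cup {p : ℕ} (h : IsWord s n i f) (hp : p < a) :
    IsWord (s + a) (n + 2) (i + p)
      (appendTwo (n + 1) (a - 1 - p) 1 (TruncatedBar.addZero p f)) := by
  refine ⟨h.one_le.trans (Nat.le_add_right _ _), ?_, ?_⟩
  · have := h.le
    simp [appendTwo, TruncatedBar.addZero, this]
  · rw [Finset.sum_range_succ, Finset.sum_range_succ]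
    have h1 : ∑ x ∈ Finset.range (n + 1),
        appendTwo (n + 1) (a - 1 - p) 1 (TruncatedBar.addZero p f) x =
        ∑ x ∈ Finset.range (n + 1), TruncatedBar.addZero p f x :=
      Finset.sum_congr rfl fun x hx => if_pos (Finset.mem_range.1 hx)
    rw [h1, sum_addZero, h.sum_eq]
    simp only [appendTwo, lt_irrefl, if_true, if_false, Nat.succ_ne_self, Nat.not_succ_lt_self]
    omega

/-- The boundary of a cup product. The faces that multiply the last `x` onto a neighbouring slot
cancel telescopically. -/
theorem boundary_cup_gen (h : IsWord s n i f) :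
    boundary (X (s + a) a) (pt (s + a) a) (n + 1) (cup s a n (gen s a n i f)) =
      (∑ c ∈ Finset.range n, (-1 : ℤ) ^ c • ∑ p ∈ Finset.range a,
        gen (s + a) a (n + 1) (i + p)
          (mergeAt c (appendTwo (n + 1) (a - 1 - p) 1 (addZero p f)))) +
      (-1 : ℤ) ^ n • ∑ p ∈ Finset.range a,
        gen (s + a) a (n + 1) (i + p)
          (mergeAt n (appendTwo (n + 1) (a - 1 - p) 1 (addZero p f))) := by
  set U : ℕ → Chains (X (s + a) a) (pt (s + a) a) (n + 1) := fun p =>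
    gen (s + a) a (n + 1) (i + p) (appendTwo (n + 1) (a - p) 0 (addZero p f)) with hU
  have hterm : ∀ p ∈ Finset.range a, boundary (X (s + a) a) (pt (s + a) a) (n + 1)
      (gen (s + a) a (n + 2) (i + p) (appendTwo (n + 1) (a - 1 - p) 1 (addZero p f))) =
      ∑ c ∈ Finset.range n, (-1 : ℤ) ^ c • gen (s + a) a (n + 1) (i + p)
          (mergeAt c (appendTwo (n + 1) (a - 1 - p) 1 (addZero p f))) +
      (-1 : ℤ) ^ n • gen (s + a) a (n + 1) (i + p)
          (mergeAt n (appendTwo (n + 1) (a - 1 - p) 1 (addZero p f))) +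
      (-1 : ℤ) ^ (n + 1) • (U p - U (p + 1)) := by
    intro p hp
    rw [Finset.mem_range] at hp
    rw [boundary_gen (h.cup hp), Finset.sum_range_succ, Finset.sum_range_succ, add_assoc]
    congr 1
    have v : appendTwo (n + 1) (a - 1 - p) 1 (addZero p f) (n + 1 + 1) = 1 := by simp [appendTwo]
    have e1 : gen (s + a) a (n + 1) (i + p)
        (mergeAt (n + 1) (appendTwo (n + 1) (a - 1 - p) 1 (addZero p f))) = U p := by
      refine gen_congr rfl fun j hj => ?_
      simp only [mergeAt, appendTwo]
      split_ifs <;> omega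
    have e2 : gen (s + a) a (n + 1) (i + p + 1)
        (addZero 1 (appendTwo (n + 1) (a - 1 - p) 1 (addZero p f))) = U (p + 1) := by
      refine gen_congr (add_assoc _ _ _) fun j hj => ?_
      simp only [addZero, appendTwo]
      split_ifs <;> omega
    rw [v, e1, e2]
    simp [pow_succ, smul_sub]
  have hU0 : U 0 = 0 := gen_eq_zero_of_le le_rfl (by simp [appendTwo])
  have hUa : U a = 0 := gen_eq_zero_of_eq_zero le_rfl (by simp [appendTwo])
  rw [cup_gen h, map_sum, Finset.sum_congr rfl hterm, Finset.sum_add_distrib,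
    Finset.sum_add_distrib, ← Finset.smul_sum, ← Finset.smul_sum, Finset.sum_range_sub', hU0, hUa,
    sub_zero, smul_zero, add_zero, Finset.sum_comm]
  simp only [Finset.smul_sum]

theorem boundary_cup_zero (z : Chains (X s a) (pt s a) 0) :
    boundary (X (s + a) a) (pt (s + a) a) 1 (cup s a 0 z) = 0 := by
  suffices h : boundary (X (s + a) a) (pt (s + a) a) 1 ∘ₗ cup s a 0 = 0 from
    LinearMap.congr_fun h z
  refine chains_ext_gen fun i f h => ?_
  rw [LinearMap.comp_apply, boundary_cup_gen h.toIsWord, Finset.sum_range_zero, zero_add,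
    Finset.sum_eq_zero, smul_zero, LinearMap.zero_apply]
  intro p hp
  rw [Finset.mem_range] at hp
  have := h.pos 0 le_rfl
  refine gen_eq_zero_of_le (Nat.zero_le _) ?_
  simp [mergeAt, appendTwo, addZero]
  omega

theorem boundary_cup_succ (z : Chains (X s a) (pt s a) (n + 1)) :
    boundary (X (s + a) a) (pt (s + a) a) (n + 2) (cup s a (n + 1) z) =
      cup s a n (boundary (X s a) (pt s a) n z) := by
  suffices h : boundary (X (s + a) a) (pt (s + a) a) (n + 2) ∘ₗ cup s a (n + 1) =
      cup s a n ∘ₗ boundary (X s a) (pt s a) n from LinearMap.congr_fun h z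
  refine chains_ext_gen fun i f h => ?_
  rw [LinearMap.comp_apply, LinearMap.comp_apply, boundary_cup_gen h.toIsWord,
    boundary_gen h.toIsWord, map_add, map_sum, map_smul]
  simp only [map_smul]
  congr 1
  · refine Finset.sum_congr rfl fun c hc => ?_
    rw [Finset.mem_range] at hc
    rw [cup_gen (h.toIsWord.mergeAt (by omega))]
    congr 1
    refine Finset.sum_congr rfl fun p _ => gen_congr rfl fun j hj => ?_
    by_cases hj' : j < n + 1
    · rw [appendTwo, if_pos hj', ← mergeAt_addZero]
      simp only [mergeAt, appendTwo]
      split_ifs <;> omega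
    · simp only [mergeAt, appendTwo]
      split_ifs <;> omega
  · congr 1
    rw [cup_gen h.toIsWord.addZero_last]
    set b := f (n + 1) with hb
    set V : ℕ → Chains (X (s + a) a) (pt (s + a) a) (n + 2) := fun p =>
      gen (s + a) a (n + 2) (i + p)
        (mergeAt (n + 1) (appendTwo (n + 1 + 1) (a - 1 - p) 1 (addZero p f))) with hV
    have hf0 := h.pos 0 (Nat.zero_le _)
    have hba : b < a := h.lt (n + 1) le_rfl
    have hVa : ∀ p, a ≤ p → V p = 0 := fun p hp => by
      refine gen_eq_zero_of_le (Nat.zero_le _) ?_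
      simp [mergeAt, appendTwo, addZero]
      omega
    have hVb : ∀ p, p < b → V p = 0 := fun p hp => by
      refine gen_eq_zero_of_le (j := n + 1) (by omega) ?_
      simp [mergeAt, appendTwo, addZero]
      omega
    have e1 : ∑ p ∈ Finset.range a, V p = ∑ p ∈ Finset.range (b + a), V p :=
      Finset.sum_subset (Finset.range_mono (Nat.le_add_left _ _)) fun p _ hp =>
        hVa p (by simpa using hp)
    change ∑ p ∈ Finset.range a, V p = _
    rw [e1, Finset.sum_range_add, Finset.sum_eq_zero fun p hp => hVb p (Finset.mem_range.1 hp),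
      zero_add]
    refine Finset.sum_congr rfl fun q hq => ?_
    by_cases hqa : a ≤ b + q
    · rw [hVa _ hqa, gen_eq_zero_of_le (Nat.zero_le _)]
      simp [appendTwo, addZero]
      omega
    · refine gen_congr (by omega) fun j hj => ?_
      simp only [addZero, mergeAt, appendTwo]
      split_ifs <;> first | omega | contradiction

theorem cup_mem_cycles {z : Chains (X s a) (pt s a) n} (hz : z ∈ cycles s a n) :
    cup s a n z ∈ cycles (s + a) a (n + 2) := by
  cases n with
  | zero => exact boundary_cup_zero z
  | succ n =>
    refine (boundary_cup_succ z).trans ?_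
    rw [show boundary (X s a) (pt s a) n z = 0 from hz, map_zero]

theorem cap_mem_cycles {z : Chains (X (s + a) a) (pt (s + a) a) (n + 2)}
    (hz : z ∈ cycles (s + a) a (n + 2)) : cap s a n z ∈ cycles s a n := by
  cases n with
  | zero => exact Submodule.mem_top
  | succ n =>
    refine (cap_boundary z).symm.trans ?_
    rw [show boundary (X (s + a) a) (pt (s + a) a) (n + 2) z = 0 from hz, map_zero]

theorem cap_cup_summand (ha : 2 ≤ a) {p t : ℕ} (hp : p < a)
    (h : IsWord (s + a) (n + 2) t (appendTwo (n + 1) (a - 1 - p) 1 (addZero p f))) :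
    cap s a n (gen (s + a) a (n + 2) t (appendTwo (n + 1) (a - 1 - p) 1 (addZero p f))) =
      if p = 0 then gen s a n t f else 0 := by
  have v1 : appendTwo (n + 1) (a - 1 - p) 1 (addZero p f) (n + 1) = a - 1 - p := by
    simp [appendTwo]
  have v2 : appendTwo (n + 1) (a - 1 - p) 1 (addZero p f) (n + 2) = 1 := by simp [appendTwo]
  rw [cap_gen h (by rw [v1]; omega) (by rw [v2]; omega), v1, v2]
  by_cases h0 : p = 0
  · subst h0
    rw [if_pos (by omega), if_pos rfl]
    refine gen_congr (by omega) fun j hj => ?_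
    simp only [addZero, appendTwo]
    split_ifs <;> first | omega | (subst_vars; omega)
  · rw [if_neg (by omega), if_neg h0]

theorem cap_cup (ha : 2 ≤ a) (z : Chains (X s a) (pt s a) n) :
    cap s a n (cup s a n z) = z := by
  suffices h : cap s a n ∘ₗ cup s a n = LinearMap.id from LinearMap.congr_fun h z
  refine chains_ext_gen fun i f h => ?_
  rw [LinearMap.comp_apply, cup_gen h.toIsWord, map_sum, Finset.sum_eq_single_of_mem 0
    (Finset.mem_range.2 (by omega))]
  · rw [cap_cup_summand ha (by omega) (h.toIsWord.cup (by omega)), if_pos rfl]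
    rfl
  · intro p hp h0
    rw [Finset.mem_range] at hp
    rw [cap_cup_summand ha hp (h.toIsWord.cup hp), if_neg h0]

/-- The rotation commutes with the periodicity. -/
theorem cap_rot_cup (ha : 2 ≤ a) (z : Chains (X s a) (pt s a) n) :
    cap s a n (rot (s + a) a (n + 2) (cup s a n z)) = rot s a n z := by
  suffices h : cap s a n ∘ₗ rot (s + a) a (n + 2) ∘ₗ cup s a n = rot s a n from
    LinearMap.congr_fun h z
  refine chains_ext_gen fun i f h => ?_
  have hi := h.one_le
  have hfn := h.pos n le_rfl
  have hfl := h.lt n le_rfl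
  rw [LinearMap.comp_apply, LinearMap.comp_apply, cup_gen h.toIsWord, map_sum, map_sum,
    Finset.sum_eq_single_of_mem 0 (Finset.mem_range.2 (by omega))]
  · have hw := h.toIsWord.cup (p := 0) (by omega : 0 < a)
    rw [add_zero] at hw ⊢
    rcases hi.lt_or_eq with h1 | rfl
    · rw [rot_gen_of_one_lt hw h1, rot_gen_of_one_lt h.toIsWord h1, cap_cup_summand ha (by omega),
        if_pos rfl]
      exact ⟨by omega, (Nat.sub_le _ _).trans hw.le, hw.sum_eq⟩
    · have v : appendTwo (n + 1) (a - 1 - 0) 1 (addZero 0 f) (n + 2) = 1 := by simp [appendTwo]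
      have hc := hw.cycle (by rw [v]; omega)
      rw [rot_gen_one hw (by rw [v]; omega), rot_gen_one h.toIsWord hfn, map_smul]
      set F := cycle (n + 2) (appendTwo (n + 1) (a - 1 - 0) 1 (addZero 0 f)) with hF
      have v1 : F (n + 1) = f n := by simp [hF, cycle, appendTwo, addZero]; rintro rfl; rfl
      have v2 : F (n + 2) = a - 1 := by simp [hF, cycle, appendTwo]
      have v0 : F 0 = 1 := by simp [hF, cycle, appendTwo]
      rw [cap_gen hc (by omega) (by omega), v1, v2, if_pos (by omega), v]
      rw [show (-1 : ℤ) ^ (n + 2) = (-1) ^ n by ring]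
      congr 1
      refine gen_congr (by omega) fun j hj => ?_
      rw [addZero, v0]
      simp only [cycle, hF, appendTwo, addZero]
      split_ifs with h1 h2 h3 <;> first | omega | skip
      rw [h3, add_zero]
  · intro p hp h0
    rw [Finset.mem_range] at hp
    have hw := h.toIsWord.cup hp
    rw [rot_gen_of_one_lt hw (by omega), cap_cup_summand ha hp, if_neg h0]
    exact ⟨by omega, (Nat.sub_le _ _).trans hw.le, hw.sum_eq⟩

/-! ### Homology of the chain complex -/

variable {M : Type} [AddCommGroup M]

/-- The data `L` exhibits the submodule `N` of `M` as the homology of `X_{s,a}` in degree `q`, with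
the rotation acting as `σ`, and the homology vanishes in all other degrees. -/
structure HomologyModel (s a q : ℕ) (σ : M →ₗ[ℤ] M) (N : Submodule ℤ M) where
  /-- the map from chains inducing the isomorphism on homology -/
  L : Chains (X s a) (pt s a) q →ₗ[ℤ] M
  L_boundary : ∀ y, L (boundary (X s a) (pt s a) q y) = 0
  mem_range_of_L_eq_zero : ∀ z ∈ cycles s a q, L z = 0 →
    z ∈ LinearMap.range (boundary (X s a) (pt s a) q)
  L_mem : ∀ z ∈ cycles s a q, L z ∈ N
  exists_L_eq : ∀ m ∈ N, ∃ z ∈ cycles s a q, L z = m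
  L_rot : ∀ z ∈ cycles s a q, L (rot s a q z) = σ (L z)
  acyclic : ∀ n ≠ q, ∀ z ∈ cycles s a n, z ∈ LinearMap.range (boundary (X s a) (pt s a) n)

theorem rot_mem_cycles {z : Chains (X s a) (pt s a) n} (hz : z ∈ cycles s a n) :
    rot s a n z ∈ cycles s a n := by
  cases n with
  | zero => exact Submodule.mem_top
  | succ n =>
    refine (LinearMap.congr_fun (rot_boundary s a n) z).symm.trans ?_
    rw [LinearMap.comp_apply, show boundary (X s a) (pt s a) n z = 0 from hz, map_zero]

theorem eq_zero_of_forall_not_isGood (h : ∀ i f, ¬ IsGood s a n i f)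
    (z : Chains (X s a) (pt s a) n) : z = 0 := by
  have : (LinearMap.id : Chains (X s a) (pt s a) n →ₗ[ℤ] _) = 0 :=
    chains_ext_gen fun i f hf => (h i f hf).elim
  exact LinearMap.congr_fun this z

theorem mem_range_boundary_of_eq_zero {z : Chains (X s a) (pt s a) n} (h : z = 0) :
    z ∈ LinearMap.range (boundary (X s a) (pt s a) n) :=
  h ▸ Submodule.zero_mem _

theorem not_isGood_zero (h : a ≤ s) : ¬ IsGood s a 0 i f := fun hf => by
  have h1 := hf.sum_eq
  have h2 := hf.lt 0 le_rfl
  rw [Finset.sum_range_one] at h1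
  omega

/-- A cycle is a boundary if no word has last two slots of total degree `a`. -/
theorem mem_range_boundary_of_ne {m : ℕ}
    (h : ∀ i f, IsGood s a (m + 1) i f → f m + f (m + 1) ≠ a)
    {z : Chains (X s a) (pt s a) (m + 1)} (hz : z ∈ cycles s a (m + 1)) :
    z ∈ LinearMap.range (boundary (X s a) (pt s a) (m + 1)) := by
  refine mem_range_boundary_of_defect 0 (fun i f hf => ?_) (fun _ => rfl) hz rfl
  have := defect_gen_succ hf
  rwa [if_neg (h i f hf)] at this

/-- Periodicity of the homology: capping with the two-dimensional class lowers the degree by `2` and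
the weight by `a`. -/
noncomputable def HomologyModel.periodic {q : ℕ} {σ : M →ₗ[ℤ] M} {N : Submodule ℤ M}
    (m : HomologyModel s a q σ N) (ha : 2 ≤ a) (hs : 1 ≤ s) :
    HomologyModel (s + a) a (q + 2) σ N where
  L := m.L ∘ₗ cap s a q
  L_boundary y := by rw [LinearMap.comp_apply, cap_boundary, m.L_boundary]
  mem_range_of_L_eq_zero z hz hL := by
    obtain ⟨y, hy⟩ := m.mem_range_of_L_eq_zero _ (cap_mem_cycles hz) hL
    have h1 : boundary (X (s + a) a) (pt (s + a) a) (q + 2) (cup s a (q + 1) y) ∈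
        LinearMap.range (boundary (X (s + a) a) (pt (s + a) a) (q + 2)) :=
      LinearMap.mem_range_self _ _
    refine (Submodule.sub_mem_iff_left _ h1).1 (mem_range_boundary_of_cap_eq_zero
      (Submodule.sub_mem _ hz (boundary_mem_cycles _)) ?_)
    rw [map_sub, boundary_cup_succ, cap_cup ha, hy, sub_self]
  L_mem z hz := m.L_mem _ (cap_mem_cycles hz)
  exists_L_eq x hx := by
    obtain ⟨z, hz, rfl⟩ := m.exists_L_eq x hx
    exact ⟨cup s a q z, cup_mem_cycles hz, by rw [LinearMap.comp_apply, cap_cup ha]⟩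
  L_rot z hz := by
    -- modulo boundaries, `z` is a cup product, for which the rotation is under control
    obtain ⟨y, hy⟩ := mem_range_boundary_of_cap_eq_zero
      (Submodule.sub_mem _ hz (cup_mem_cycles (cap_mem_cycles hz)))
      (by rw [map_sub, cap_cup ha, sub_self])
    have h1 : z = cup s a q (cap s a q z) +
        boundary (X (s + a) a) (pt (s + a) a) (q + 2) y := by rw [hy]; abel
    have h2 : rot (s + a) a (q + 2) (boundary (X (s + a) a) (pt (s + a) a) (q + 2) y) =
        boundary (X (s + a) a) (pt (s + a) a) (q + 2) (rot (s + a) a (q + 3) y) :=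
      LinearMap.congr_fun (rot_boundary (s + a) a (q + 2)) y
    conv_lhs => rw [h1]
    rw [map_add, h2, LinearMap.comp_apply, map_add, cap_rot_cup ha, cap_boundary, map_add,
      m.L_boundary, add_zero, m.L_rot _ (cap_mem_cycles hz)]
    rfl
  acyclic n hn z hz := by
    match n, hn, z, hz with
    | 0, _, z, _ =>
      exact mem_range_boundary_of_eq_zero
        (eq_zero_of_forall_not_isGood (fun _ _ => not_isGood_zero (by omega)) z)
    | 1, _, z, hz =>
      refine mem_range_boundary_of_ne (fun i f hf => ?_) hz
      have := hf.sum_eq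
      rw [Finset.sum_range_succ, Finset.sum_range_one] at this
      change f 0 + f 1 ≠ a
      omega
    | n + 2, hn, z, hz =>
      obtain ⟨y, hy⟩ := m.acyclic n (by omega) _ (cap_mem_cycles hz)
      have h1 : boundary (X (s + a) a) (pt (s + a) a) (n + 2) (cup s a (n + 1) y) ∈
          LinearMap.range (boundary (X (s + a) a) (pt (s + a) a) (n + 2)) :=
        LinearMap.mem_range_self _ _
      refine (Submodule.sub_mem_iff_left _ h1).1 (mem_range_boundary_of_cap_eq_zero
        (Submodule.sub_mem _ hz (boundary_mem_cycles _)) ?_)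
      rw [map_sub, boundary_cup_succ, cap_cup ha, hy, sub_self]

theorem IsGood.last_two_le {m : ℕ} (h : IsGood s a (m + 1) i f) : f m + f (m + 1) ≤ s := by
  have := h.sum_eq
  rw [Finset.sum_range_succ, Finset.sum_range_succ] at this
  omega

theorem IsGood.last_two_lt {m : ℕ} (h : IsGood s a (m + 2) i f) : f (m + 1) + f (m + 2) < s := by
  have h1 := h.sum_eq
  have h2 := h.pos 0 (Nat.zero_le _)
  rw [Finset.sum_range_succ, Finset.sum_range_succ, Finset.sum_range_succ'] at h1
  omega

/-- For `s < a` all words are allowed, so that the chain complex is that of a simplex. -/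
noncomputable def homologyModelOfLt (hs : 1 ≤ s) (hsa : s < a) :
    HomologyModel s a 0 (LinearMap.id : ℤ →ₗ[ℤ] ℤ) ⊤ :=
  let L : Chains (X s a) (pt s a) 0 →ₗ[ℤ] ℤ := genLift fun _ _ => 1
  have hL : ∀ i f, IsWord s 0 i f → L (gen s a 0 i f) = 1 := fun i f h => by
    have h1 := h.sum_eq
    have h2 := h.one_le
    have h3 := h.le
    rw [zero_add, Finset.sum_range_one] at h1
    refine genLift_gen (fun _ _ _ _ => rfl) ⟨h, fun j hj => ?_, fun j hj => ?_⟩ <;>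
    · obtain rfl : j = 0 := by omega
      omega
  have hLb : ∀ y, L (boundary (X s a) (pt s a) 0 y) = 0 := by
    suffices h : L ∘ₗ boundary (X s a) (pt s a) 0 = 0 from fun y => LinearMap.congr_fun h y
    refine chains_ext_gen fun i f h => ?_
    rw [LinearMap.comp_apply, boundary_gen h.toIsWord, zero_add, Finset.sum_range_one, map_add,
      map_smul, map_smul, hL _ _ (h.toIsWord.mergeAt le_rfl), hL _ _ h.toIsWord.addZero_last]
    rfl
  have hgen : L (gen s a 0 s fun _ => s) = 1 := hL _ _ ⟨hs, le_rfl, by simp⟩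
  { L := L
    L_boundary := hLb
    mem_range_of_L_eq_zero := fun z hz h0 => by
      refine mem_range_boundary_of_defect (L.smulRight (gen s a 0 s fun _ => s))
        (fun i f hf => ?_) (fun y => ?_) hz ?_
      · rw [LinearMap.smulRight_apply, hL _ _ hf.toIsWord, one_smul]
        exact defect_gen_zero hf
      · rw [LinearMap.smulRight_apply, hLb, zero_smul]
      · rw [LinearMap.smulRight_apply, h0, zero_smul]
    L_mem := fun _ _ => Submodule.mem_top
    exists_L_eq := fun m _ => ⟨m • gen s a 0 s fun _ => s, Submodule.mem_top, by
      rw [map_smul, hgen, smul_eq_mul, mul_one]⟩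
    L_rot := by
      suffices h : L ∘ₗ rot s a 0 = L from fun z _ => LinearMap.congr_fun h z
      refine chains_ext_gen fun i f h => ?_
      rw [LinearMap.comp_apply]
      rcases h.one_le.lt_or_eq with h1 | rfl
      · rw [rot_gen_of_one_lt h.toIsWord h1, hL _ _ h.toIsWord,
          hL _ _ ⟨by omega, (Nat.sub_le _ _).trans h.le, h.sum_eq⟩]
      · rw [rot_gen_one h.toIsWord (h.pos 0 le_rfl), pow_zero, one_smul, hL _ _ h.toIsWord,
          hL _ _ (h.toIsWord.cycle (h.pos 0 le_rfl))]
    acyclic := fun n hn z hz => by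
      obtain ⟨m, rfl⟩ := Nat.exists_eq_succ_of_ne_zero hn
      refine mem_range_boundary_of_ne (fun i f hf => ?_) hz
      have := hf.last_two_le
      omega }

/-- The map `ℤ[ZMod a] → ℤ[ZMod a]` given by translation by `1`. -/
noncomputable def translate (a : ℕ) : (ZMod a →₀ ℤ) →ₗ[ℤ] (ZMod a →₀ ℤ) :=
  Finsupp.lmapDomain ℤ ℤ (· + 1)

/-- The augmentation `ℤ[ZMod a] → ℤ`. -/
noncomputable def augmentation (a : ℕ) : (ZMod a →₀ ℤ) →ₗ[ℤ] ℤ :=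
  Finsupp.linearCombination ℤ fun _ => 1

/-- Minus the position of a cut of the cyclic word `x₀ x ⋯ x`, as a basis vector of
`ℤ[ZMod a]`. -/
noncomputable def cut (a i : ℕ) : ZMod a →₀ ℤ := Finsupp.single (-(i : ZMod a)) 1

theorem translate_cut (h : 1 ≤ i) : translate a (cut a i) = cut a (i - 1) := by
  rw [translate, cut, Finsupp.lmapDomain_apply, Finsupp.mapDomain_single, cut, Nat.cast_sub h]
  congr 1
  push_cast
  ring

theorem cut_add_self : cut a (i + a) = cut a i := by simp [cut]

theorem augmentation_cut : augmentation a (cut a i) = 1 := by simp [augmentation, cut]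

/-- For `s = a` only the words `x^{i-1} x₀ x^{a-i}` are omitted, so that the chain complex is that
of a simplex modulo its vertices. The homology sits in degree `1`, where the class of an edge is the
difference of its vertices. -/
noncomputable def homologyModelOfEq (ha : 2 ≤ a) :
    HomologyModel a a 1 (translate a) (LinearMap.ker (augmentation a)) :=
  have : NeZero a := ⟨by omega⟩
  let L : Chains (X a a) (pt a a) 1 →ₗ[ℤ] (ZMod a →₀ ℤ) :=
    genLift fun i f => cut a i - cut a (i + f 1)
  have hL : ∀ i f, IsWord a 1 i f → 0 < f 1 → L (gen a a 1 i f) = cut a i - cut a (i + f 1) :=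
    fun i f h hp => by
      have h1 := h.sum_eq
      have h2 := h.one_le
      have h3 := h.le
      rw [Finset.sum_range_succ, Finset.sum_range_one] at h1
      refine genLift_gen (fun i f g hfg => by rw [hfg 1 le_rfl])
        ⟨h, fun j hj => ?_, fun j hj => ?_⟩ <;>
      · rcases (show j = 0 ∨ j = 1 by omega) with rfl | rfl <;> omega
  have hLb : ∀ y, L (boundary (X a a) (pt a a) 1 y) = 0 := by
    suffices h : L ∘ₗ boundary (X a a) (pt a a) 1 = 0 from fun y => LinearMap.congr_fun h y
    refine chains_ext_gen fun i f h => ?_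
    have p1 := h.pos 1 (by omega)
    have p2 := h.pos 2 (by omega)
    have v0 : mergeAt 0 f 1 = f 2 := by simp [mergeAt]
    have v1 : mergeAt 1 f 1 = f 1 + f 2 := by simp [mergeAt]
    have v2 : addZero (f 2) f 1 = f 1 := by simp [addZero]
    rw [LinearMap.comp_apply, boundary_gen h.toIsWord, Finset.sum_range_succ, Finset.sum_range_one,
      map_add, map_add, map_smul, map_smul, map_smul,
      hL _ _ (h.toIsWord.mergeAt (by omega)) (by omega),
      hL _ _ (h.toIsWord.mergeAt (by omega)) (by omega),
      hL _ _ h.toIsWord.addZero_last (v2 ▸ p1)]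
    change _ + (-1 : ℤ) ^ 2 • (cut a (i + f 2) - cut a (i + f 2 + addZero (f 2) f 1)) = 0
    rw [v0, v1, v2, show i + f 2 + f 1 = i + (f 1 + f 2) by ring]
    simp
  let e : ℕ → Chains (X a a) (pt a a) 1 := fun q => gen a a 1 q (appendTwo 0 (a - 1) 1 id)
  let Q : (ZMod a →₀ ℤ) →ₗ[ℤ] Chains (X a a) (pt a a) 1 :=
    Finsupp.linearCombination ℤ fun t => ∑ q ∈ Finset.Ico (a - t.val) a, e q
  have hQ : ∀ i, 1 ≤ i → i ≤ a → Q (cut a i) = ∑ q ∈ Finset.Ico i a, e q := fun i h1 h2 => by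
    have hv : a - (-(i : ZMod a)).val = i := by
      rcases h2.lt_or_eq with h3 | rfl
      · have h4 : (i : ZMod a) ≠ 0 := fun h => by
          rw [ZMod.natCast_eq_zero_iff] at h
          exact absurd (Nat.le_of_dvd h1 h) (by omega)
        have : NeZero (i : ZMod a) := ⟨h4⟩
        rw [ZMod.val_neg_of_ne_zero, ZMod.val_natCast_of_lt h3]
        omega
      · simp
    simp [Q, cut, hv]
  have he : ∀ q, 1 ≤ q → q < a → L (e q) = cut a q - cut a (q + 1) := fun q h1 h2 => by
    have v : appendTwo 0 (a - 1) 1 id 1 = 1 := by simp [appendTwo]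
    have := hL q (appendTwo 0 (a - 1) 1 id)
      ⟨h1, by simp [appendTwo]; omega, by simp [Finset.sum_range_succ, appendTwo]; omega⟩
      (by rw [v]; exact one_pos)
    rwa [v] at this
  have hC : ∀ z : Chains (X a a) (pt a a) 0, z = 0 :=
    eq_zero_of_forall_not_isGood fun _ _ => not_isGood_zero le_rfl
  { L := L
    L_boundary := hLb
    mem_range_of_L_eq_zero := fun z hz h0 => by
      refine mem_range_boundary_of_defect (Q ∘ₗ L) (fun i f hf => ?_) (fun y => ?_) hz ?_
      · have h1 := hf.sum_eq
        have h2 := hf.one_le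
        have h3 := hf.le
        have p := hf.pos 1 le_rfl
        rw [Finset.sum_range_succ, Finset.sum_range_one] at h1
        have hd := defect_gen_succ hf
        rw [if_pos (show f 0 + f (0 + 1) = a from h1)] at hd
        have h4 : gen a a (0 + 1) i (appendTwo 0 (a - 1) 1 f) = e i :=
          gen_congr rfl fun j _ => by simp [appendTwo]
        rw [h4] at hd
        rw [LinearMap.comp_apply, hL _ _ hf.toIsWord p, map_sub, hQ i h2 (by omega),
          hQ _ (by omega) (by omega), ← Finset.sum_Ico_consecutive e (show i ≤ i + f 1 by omega)
          (show i + f 1 ≤ a by omega), add_sub_cancel_right,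
          Finset.sum_eq_sum_Ico_succ_bot (show i < i + f 1 by omega), ← sub_sub]
        refine Submodule.sub_mem _ hd (Submodule.sum_mem _ fun q hq => gen_mem_posFil ?_)
        exact (Finset.mem_Ico.1 hq).1
      · rw [LinearMap.comp_apply, hLb, map_zero]
      · rw [LinearMap.comp_apply, h0, map_zero]
    L_mem := by
      suffices h : augmentation a ∘ₗ L = 0 from fun z _ => LinearMap.congr_fun h z
      refine chains_ext_gen fun i f h => ?_
      rw [LinearMap.comp_apply, hL _ _ h.toIsWord (h.pos 1 le_rfl), map_sub, augmentation_cut,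
        augmentation_cut, sub_self, LinearMap.zero_apply]
    exists_L_eq := fun m hm => by
      have h1 : L ∘ₗ Q = LinearMap.id - (augmentation a).smulRight (cut a a) := by
        refine Finsupp.lhom_ext' fun t => LinearMap.ext_ring ?_
        have ht := t.val_lt
        have h2 : Finsupp.single t 1 = cut a (a - t.val) := by
          rw [cut, Nat.cast_sub ht.le]
          simp
        change L (Q (Finsupp.single t 1)) = Finsupp.single t 1 -
          augmentation a (Finsupp.single t 1) • cut a a
        rw [h2, hQ _ (by omega) (by omega), augmentation_cut, one_smul, map_sum,
          Finset.sum_congr rfl fun q hq => he q (by rw [Finset.mem_Ico] at hq; omega)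
            (Finset.mem_Ico.1 hq).2]
        rw [← neg_inj, ← Finset.sum_neg_distrib]
        simp only [neg_sub]
        exact Finset.sum_Ico_sub (cut a) (by omega)
      refine ⟨Q m, hC _, (LinearMap.congr_fun h1 m).trans ?_⟩
      have hm' : augmentation a m = 0 := hm
      simp [hm']
    L_rot := by
      suffices h : L ∘ₗ rot a a 1 = translate a ∘ₗ L from fun z _ => LinearMap.congr_fun h z
      refine chains_ext_gen fun i f h => ?_
      have p0 := h.pos 0 (by omega)
      have p := h.pos 1 le_rfl
      have h2 := h.one_le
      have h1 := h.sum_eq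
      rw [Finset.sum_range_succ, Finset.sum_range_one] at h1
      rw [LinearMap.comp_apply, LinearMap.comp_apply, hL _ _ h.toIsWord p, map_sub,
        translate_cut h2, translate_cut (by omega)]
      rcases h2.lt_or_eq with h3 | rfl
      · rw [rot_gen_of_one_lt h.toIsWord h3,
          hL _ _ ⟨by omega, (Nat.sub_le _ _).trans h.le, h.sum_eq⟩ p,
          show i - 1 + f 1 = i + f 1 - 1 by omega]
      · have v : cycle 1 f 1 = f 0 := by simp [cycle]
        rw [rot_gen_one h.toIsWord p, map_smul, hL _ _ (h.toIsWord.cycle p) (v ▸ p0), v,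
          show f 1 + f 0 = 0 + a by omega, cut_add_self, show 1 - 1 = 0 from rfl,
          show 1 + f 1 - 1 = f 1 by omega]
        simp
    acyclic := fun n hn z hz => by
      match n, hn, z, hz with
      | 0, _, z, _ => exact mem_range_boundary_of_eq_zero (hC z)
      | n + 2, _, z, hz =>
        exact mem_range_boundary_of_ne (fun i f hf => hf.last_two_lt.ne) hz }

/-- For `a = 1` every word is identified with the base point. -/
noncomputable def homologyModelOne (s q : ℕ) :
    HomologyModel s 1 q (translate 1) (LinearMap.ker (augmentation 1)) :=
  have hC : ∀ n, ∀ z : Chains (X s 1) (pt s 1) n, z = 0 := fun n =>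
    eq_zero_of_forall_not_isGood fun i f h => by
      have h1 := h.pos 0 (Nat.zero_le _)
      have h2 := h.lt 0 (Nat.zero_le _)
      omega
  { L := 0
    L_boundary := fun _ => rfl
    mem_range_of_L_eq_zero := fun z _ _ => mem_range_boundary_of_eq_zero (hC q z)
    L_mem := fun _ _ => Submodule.zero_mem _
    exists_L_eq := fun m hm => by
      refine ⟨0, Submodule.zero_mem _, ?_⟩
      have h1 : m = Finsupp.single 0 (m 0) := by
        refine Finsupp.ext fun t => ?_
        obtain rfl : t = 0 := Subsingleton.elim (α := Fin 1) _ _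
        simp
      have h2 : augmentation 1 m = 0 := hm
      rw [h1] at h2 ⊢
      have h3 : m 0 = 0 := by simpa [augmentation] using h2
      rw [h3]
      simp
    L_rot := fun _ _ => by simp
    acyclic := fun n _ z _ => mem_range_boundary_of_eq_zero (hC n z) }

theorem nonempty_homologyModel_of_not_dvd {r : ℕ} (ha : 2 ≤ a) (hr : 1 ≤ r) (hra : r < a) (d : ℕ) :
    Nonempty (HomologyModel (r + d * a) a (2 * d) (LinearMap.id : ℤ →ₗ[ℤ] ℤ) ⊤) := by
  induction d with
  | zero => rw [zero_mul, add_zero]; exact ⟨homologyModelOfLt hr hra⟩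
  | succ d ih =>
    rw [Nat.succ_mul, ← add_assoc]
    exact ⟨ih.some.periodic ha (by omega)⟩

theorem nonempty_homologyModel_of_dvd (ha : 1 ≤ a) (d : ℕ) :
    Nonempty (HomologyModel (a + d * a) a (2 * d + 1) (translate a)
      (LinearMap.ker (augmentation a))) := by
  rcases ha.lt_or_eq with ha | rfl
  · induction d with
    | zero => rw [zero_mul, add_zero]; exact ⟨homologyModelOfEq ha⟩
    | succ d ih =>
      rw [Nat.succ_mul, ← add_assoc]
      exact ⟨ih.some.periodic ha (by omega)⟩
  · exact ⟨homologyModelOne _ _⟩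

/-! ### From chains to homology representations -/

variable {q : ℕ}

/-- The chain complex of `X_{s,a}`. -/
noncomputable abbrev cplx (s a : ℕ) : ChainComplex (ModuleCat.{0} ℤ) ℕ :=
  reducedChains (X s a) (pt s a)

theorem cplx_d (y : Chains (X s a) (pt s a) (q + 1)) :
    (cplx s a).d (q + 1) q y = boundary (X s a) (pt s a) q y :=
  congrArg (fun φ => φ.hom y) (reducedChains_d (X s a) (pt s a) q)

theorem iCycles_mem_cycles (x : (cplx s a).cycles q) : (cplx s a).iCycles q x ∈ cycles s a q := by
  cases q with
  | zero => trivial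
  | succ q =>
    refine (cplx_d _).symm.trans ?_
    exact congrArg (fun φ => φ.hom x) ((cplx s a).iCycles_d (q + 1) q)

theorem exists_iCycles_eq {z : Chains (X s a) (pt s a) q} (hz : z ∈ cycles s a q) :
    ∃ x : (cplx s a).cycles q, (cplx s a).iCycles q x = z := by
  let k : ModuleCat.of ℤ ℤ ⟶ (cplx s a).X q :=
    ModuleCat.ofHom (LinearMap.toSpanSingleton ℤ (Chains (X s a) (pt s a) q) z)
  have hk : k ≫ (cplx s a).d q ((ComplexShape.down ℕ).next q) = 0 := by
    cases q with
    | zero => rw [(cplx s a).shape, Limits.comp_zero]; simp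
    | succ q =>
      rw [ChainComplex.next_nat_succ]
      ext
      change (cplx s a).d (q + 1) q ((1 : ℤ) • z) = 0
      rw [one_smul]
      exact (cplx_d z).trans hz
  refine ⟨(cplx s a).liftCycles k _ rfl hk (1 : ℤ), ?_⟩
  refine (congrArg (fun φ => φ.hom (1 : ℤ)) ((cplx s a).liftCycles_i k _ rfl hk)).trans ?_
  exact one_smul ℤ z

theorem homologyπ_eq_zero {x : (cplx s a).cycles q}
    (h : (cplx s a).iCycles q x ∈ LinearMap.range (boundary (X s a) (pt s a) q)) :
    (cplx s a).homologyπ q x = 0 := by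
  obtain ⟨y, hy⟩ := h
  have h1 : (cplx s a).toCycles (q + 1) q y = x := by
    have hi : Function.Injective ((cplx s a).iCycles q) :=
      (ModuleCat.mono_iff_injective _).1 inferInstance
    apply hi
    refine (congrArg (fun φ => φ.hom y) ((cplx s a).toCycles_i (q + 1) q)).trans ?_
    exact (cplx_d y).trans hy
  rw [← h1]
  exact congrArg (fun φ => φ.hom y) ((cplx s a).toCycles_comp_homologyπ (q + 1) q)

theorem exists_homologyπ_eq (y : (cplx s a).homology q) : ∃ x, (cplx s a).homologyπ q x = y :=
  (ModuleCat.epi_iff_surjective _).1 inferInstance y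

theorem isZero_homologyRep [NeZero s] (h : ∀ z ∈ cycles s a q,
    z ∈ LinearMap.range (boundary (X s a) (pt s a) q)) :
    Limits.IsZero (homologyRep s a q) := by
  rw [Rep.isZero_iff]
  refine ⟨fun y y' => ?_⟩
  have key : ∀ y : (cplx s a).homology q, y = 0 := fun y => by
    obtain ⟨x, rfl⟩ := exists_homologyπ_eq y
    exact homologyπ_eq_zero (h _ (iCycles_mem_cycles x))
  exact (key y).trans (key y').symm

/-- The map on homology induced by a linear map on chains that vanishes on boundaries. -/
noncomputable def homologyLift (L : Chains (X s a) (pt s a) q →ₗ[ℤ] M)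
    (hL : ∀ y, L (boundary (X s a) (pt s a) q y) = 0) :
    (cplx s a).homology q →ₗ[ℤ] M :=
  ((cplx s a).homologyι q ≫ (cplx s a).descOpcycles (A := ModuleCat.of ℤ M) (ModuleCat.ofHom L)
    (q + 1) (by simp) (by
      ext y
      exact (congrArg L (cplx_d y)).trans (hL y))).hom

theorem homologyLift_π (L : Chains (X s a) (pt s a) q →ₗ[ℤ] M)
    (hL : ∀ y, L (boundary (X s a) (pt s a) q y) = 0) (x : (cplx s a).cycles q) :
    homologyLift L hL ((cplx s a).homologyπ q x) = L ((cplx s a).iCycles q x) := by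
  have h : (cplx s a).homologyπ q ≫ ModuleCat.ofHom (homologyLift L hL) =
      (cplx s a).iCycles q ≫ ModuleCat.ofHom L := by
    change (cplx s a).homologyπ q ≫ ((cplx s a).homologyι q ≫ (cplx s a).descOpcycles _ _ _ _) = _
    rw [HomologicalComplex.homology_π_ι_assoc]
    exact congrArg ((cplx s a).iCycles q ≫ ·) ((cplx s a).p_descOpcycles _ _ _ _)
  exact congrArg (fun φ => φ.hom x) h

theorem homologyMap_rotation_pow_π (t : ℕ) (x : (cplx s a).cycles q) :
    ∃ x' : (cplx s a).cycles q,
      HomologicalComplex.homologyMap ((rotation s a) ^ t : End (cplx s a)) q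
        ((cplx s a).homologyπ q x) = (cplx s a).homologyπ q x' ∧
      (cplx s a).iCycles q x' = ((rot s a q) ^ t) ((cplx s a).iCycles q x) := by
  refine ⟨HomologicalComplex.cyclesMap ((rotation s a) ^ t : End (cplx s a)) q x, ?_, ?_⟩
  · exact congrArg (fun φ => φ.hom x)
      (HomologicalComplex.homologyπ_naturality ((rotation s a) ^ t : End (cplx s a)) q)
  · refine (congrArg (fun φ => φ.hom x)
      (HomologicalComplex.cyclesMap_i ((rotation s a) ^ t : End (cplx s a)) q)).trans ?_
    rw [rotation_pow_f]
    rfl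

namespace HomologyModel

variable {σ : M →ₗ[ℤ] M} {N : Submodule ℤ M} (m : HomologyModel s a q σ N)

theorem L_rot_pow (t : ℕ) : ∀ z ∈ cycles s a q, m.L (((rot s a q) ^ t) z) = (σ ^ t) (m.L z) := by
  induction t with
  | zero => intro z _; rfl
  | succ t ih =>
    intro z hz
    rw [pow_succ, Module.End.mul_apply, ih _ (rot_mem_cycles hz), m.L_rot z hz, pow_succ,
      Module.End.mul_apply]

/-- The map from homology given by a model. -/
noncomputable def homologyMap : (cplx s a).homology q →ₗ[ℤ] M := homologyLift m.L m.L_boundary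

theorem homologyMap_injective : Function.Injective m.homologyMap := by
  rw [injective_iff_map_eq_zero]
  intro y hy
  obtain ⟨x, rfl⟩ := exists_homologyπ_eq y
  rw [homologyMap, homologyLift_π] at hy
  exact homologyπ_eq_zero (m.mem_range_of_L_eq_zero _ (iCycles_mem_cycles x) hy)

theorem range_homologyMap : LinearMap.range m.homologyMap = N := by
  ext y
  constructor
  · rintro ⟨y, rfl⟩
    obtain ⟨x, rfl⟩ := exists_homologyπ_eq y
    rw [homologyMap, homologyLift_π]
    exact m.L_mem _ (iCycles_mem_cycles x)
  · intro hy
    obtain ⟨z, hz, rfl⟩ := m.exists_L_eq y hy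
    obtain ⟨x, rfl⟩ := exists_iCycles_eq hz
    exact ⟨(cplx s a).homologyπ q x, homologyLift_π _ _ x⟩

theorem homologyMap_homologyRep [NeZero s] (g : Multiplicative (ZMod s))
    (y : (cplx s a).homology q) :
    m.homologyMap ((homologyRep s a q).ρ g y) = (σ ^ g.toAdd.val) (m.homologyMap y) := by
  obtain ⟨x, rfl⟩ := exists_homologyπ_eq y
  obtain ⟨x', h1, h2⟩ := homologyMap_rotation_pow_π g.toAdd.val x
  refine (congrArg m.homologyMap h1).trans ?_
  rw [homologyMap, homologyLift_π, homologyLift_π, h2, m.L_rot_pow _ _ (iCycles_mem_cycles x)]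

variable [NeZero s] {V : Type} [AddCommGroup V] (e : M ≃+ V)

/-- The map from homology given by a model, with values in a representation. The identification `e`
is only additive, so that no two `ℤ`-module structures have to be compared. -/
noncomputable def repAddHom : (homologyRep s a q).V →+ V :=
  e.toAddMonoidHom.comp m.homologyMap.toAddMonoidHom

theorem repAddHom_injective : Function.Injective (m.repAddHom e) :=
  e.injective.comp m.homologyMap_injective

theorem mem_range_repAddHom {x : V} : (∃ y, m.repAddHom e y = x) ↔ e.symm x ∈ N := by
  rw [← SetLike.ext_iff.1 m.range_homologyMap]
  constructor
  · rintro ⟨y, rfl⟩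
    exact ⟨y, (e.symm_apply_apply _).symm⟩
  · rintro ⟨y, hy⟩
    exact ⟨y, (congrArg e hy).trans (e.apply_symm_apply x)⟩

theorem repAddHom_homologyRep [Module ℤ V]
    (ρ : Representation ℤ (Multiplicative (ZMod s)) V)
    (he : ∀ x, e (σ x) = ρ (Multiplicative.ofAdd 1) (e x))
    (g : Multiplicative (ZMod s)) (y : (homologyRep s a q).V) :
    m.repAddHom e ((homologyRep s a q).ρ g y) = ρ g (m.repAddHom e y) := by
  have hpow : ∀ (t : ℕ) x, e ((σ ^ t) x) = ρ (Multiplicative.ofAdd 1 ^ t) (e x) := by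
    intro t
    induction t with
    | zero => intro x; simp
    | succ t ih =>
      intro x
      rw [pow_succ, Module.End.mul_apply, ih, he, pow_succ, map_mul, Module.End.mul_apply]
  have hg : (Multiplicative.ofAdd (1 : ZMod s)) ^ g.toAdd.val = g := by
    rw [← ofAdd_nsmul, nsmul_one, ZMod.natCast_zmod_val, ofAdd_toAdd]
  refine (congrArg e (m.homologyMap_homologyRep g y)).trans ?_
  rw [hpow, hg]
  rfl

end HomologyModel

section rep

variable {k G : Type} [Ring k] [Group G] {U V W : Rep.{0} k G}

/-- An equivariant additive map as a morphism of representations, over a quotient `k` of `ℤ`. The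
case of interest is `k = ℤ`; a general `k` keeps the module structures of the representations apart
from the canonical `ℤ`-module structures. -/
def repHom (φ : U.V →+ V.V) (hk : Function.Surjective (Int.cast : ℤ → k))
    (hρ : ∀ g u, φ (U.ρ g u) = V.ρ g (φ u)) : U ⟶ V :=
  Rep.ofHom
    { φ with
      map_smul' := fun c u => by
        obtain ⟨c, rfl⟩ := hk c
        exact map_intCast_smul φ k k c u
      isIntertwining' := fun g => LinearMap.ext (hρ g) }

theorem nonempty_iso_of_bijective (φ : U.V →+ V.V) (hk : Function.Surjective (Int.cast : ℤ → k))
    (hρ : ∀ g u, φ (U.ρ g u) = V.ρ g (φ u)) (h : Function.Bijective φ) : Nonempty (U ≅ V) := by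
  have : IsIso ((forget (Rep.{0} k G)).map (repHom φ hk hρ)) := (isIso_iff_bijective _).2 h
  have := isIso_of_reflects_iso (repHom φ hk hρ) (forget (Rep.{0} k G))
  exact ⟨asIso (repHom φ hk hρ)⟩

/-- An injective equivariant map whose image is the kernel of `ψ` identifies its source with the
kernel of `ψ` in the category of representations. -/
theorem nonempty_iso_kernel (φ : U.V →+ V.V) (hk : Function.Surjective (Int.cast : ℤ → k))
    (hρ : ∀ g u, φ (U.ρ g u) = V.ρ g (φ u)) (ψ : V ⟶ W) (hφ : Function.Injective φ)
    (hψ : ∀ v, ψ.hom v = 0 ↔ ∃ u, φ u = v) : Nonempty (U ≅ Limits.kernel ψ) := by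
  have w : repHom φ hk hρ ≫ ψ = 0 := by
    refine Rep.hom_ext (Representation.IntertwiningMap.ext (LinearMap.ext fun u => ?_))
    exact (hψ _).2 ⟨u, rfl⟩
  have hmono : Mono (repHom φ hk hρ) := by
    have : Mono ((forget₂ (Rep.{0} k G) (ModuleCat.{0} k)).map (repHom φ hk hρ)) :=
      (ModuleCat.mono_iff_injective _).2 hφ
    exact (forget₂ (Rep.{0} k G) (ModuleCat.{0} k)).mono_of_mono_map this
  have hS : (ShortComplex.mk (repHom φ hk hρ) ψ w).Exact := by
    rw [← ShortComplex.exact_map_iff_of_faithful _ (forget₂ (Rep.{0} k G) (ModuleCat.{0} k)),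
      ShortComplex.moduleCat_exact_iff]
    exact fun v hv => (hψ v).1 hv
  have : Mono (ShortComplex.mk (repHom φ hk hρ) ψ w).f := hmono
  exact ⟨hS.fIsKernel.conePointUniqueUpToIso (Limits.limit.isLimit _)⟩

end rep

section cosets

/-- Reduction modulo `a`, on the cyclic group of order `s`. -/
def reduction (h : a ∣ s) : Multiplicative (ZMod s) →* Multiplicative (ZMod a) :=
  AddMonoidHom.toMultiplicative (ZMod.castHom h (ZMod a)).toAddMonoidHom

theorem reduction_surjective (h : a ∣ s) : Function.Surjective (reduction h) :=
  ZMod.castHom_surjective h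

theorem ker_reduction [NeZero s] (h : a ∣ s) : (reduction h).ker = cyclicSubgroup s (s / a) := by
  ext x
  have hs : s / (s / a) = a := Nat.div_div_self h (NeZero.ne s)
  rw [cyclicSubgroup, hs, Subgroup.mem_zpowers_iff, MonoidHom.mem_ker]
  have h1 : reduction h x = 1 ↔ ((x.toAdd.val : ℕ) : ZMod a) = 0 := by
    have : (ZMod.castHom h (ZMod a)) x.toAdd = ((x.toAdd.val : ℕ) : ZMod a) := by
      conv_lhs => rw [← ZMod.natCast_zmod_val x.toAdd]
      rw [map_natCast]
    rw [← this]
    rfl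
  rw [h1, ZMod.natCast_eq_zero_iff]
  constructor
  · rintro ⟨c, hc⟩
    refine ⟨c, ?_⟩
    rw [← ofAdd_zsmul, ← ofAdd_toAdd x]
    congr 1
    rw [← ZMod.natCast_zmod_val x.toAdd, hc]
    push_cast
    rw [natCast_zsmul, nsmul_eq_mul, mul_comm]
  · rintro ⟨c, rfl⟩
    rw [← ZMod.natCast_eq_zero_iff]
    have h2 : (ZMod.castHom h (ZMod a)) ((c : ZMod s) * (a : ZMod s)) = 0 := by
      rw [map_mul, map_natCast, ZMod.natCast_self, mul_zero]
    rw [← ofAdd_zsmul, toAdd_ofAdd, zsmul_eq_mul, ← map_natCast (ZMod.castHom h (ZMod a)),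
      ZMod.natCast_zmod_val]
    exact h2

/-- The cosets of the subgroup of index `a` in the cyclic group of order `s` are the residue classes
modulo `a`. -/
noncomputable def cosetEquiv [NeZero s] (h : a ∣ s) :
    ZMod a ≃ Multiplicative (ZMod s) ⧸ cyclicSubgroup s (s / a) :=
  (((QuotientGroup.quotientMulEquivOfEq (ker_reduction h)).symm.trans
    (QuotientGroup.quotientKerEquivOfSurjective (reduction h) (reduction_surjective h))).toEquiv.trans
      Multiplicative.toAdd).symm

theorem cosetEquiv_add_one [NeZero s] (h : a ∣ s) (t : ZMod a) :
    cosetEquiv h (t + 1) = Multiplicative.ofAdd (1 : ZMod s) • cosetEquiv h t := by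
  obtain ⟨x, rfl⟩ := (cosetEquiv h).symm.surjective t
  rw [Equiv.apply_symm_apply, ← Equiv.eq_symm_apply]
  induction x using QuotientGroup.induction_on with | H x => ?_
  change (ZMod.castHom h (ZMod a)) x.toAdd + 1 = (ZMod.castHom h (ZMod a)) (1 + x.toAdd)
  rw [map_add, map_one, add_comm]

/-- The permutation module `ℤ[ZMod a]` as a module of cosets. -/
noncomputable def cosetAddEquiv [NeZero s] (h : a ∣ s) :
    (ZMod a →₀ ℤ) ≃+ (cosetRep (cyclicSubgroup s (s / a))).V :=
  (Finsupp.domCongr (cosetEquiv h)).trans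
    (MonoidAlgebra.coeffAddEquiv
      (M := Multiplicative (ZMod s) ⧸ cyclicSubgroup s (s / a)) (R := ℤ)).symm

theorem cosetAddEquiv_single [NeZero s] (h : a ∣ s) (t : ZMod a) (c : ℤ) :
    cosetAddEquiv h (Finsupp.single t c) = MonoidAlgebra.single (cosetEquiv h t) c := by
  simp [cosetAddEquiv]

end cosets

/-! ### The homology as a module over the cyclic group -/

theorem nonempty_iso_trivial {s a q : ℕ} [NeZero s]
    (m : HomologyModel s a q (LinearMap.id : ℤ →ₗ[ℤ] ℤ) ⊤) :
    Nonempty (homologyRep s a q ≅ cosetRep (⊤ : Subgroup (Multiplicative (ZMod s)))) := by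
  have := QuotientGroup.subsingleton_quotient_top (G := Multiplicative (ZMod s))
  let E := Representation.ofMulActionSubsingletonEquivTrivial ℤ (Multiplicative (ZMod s))
    (Multiplicative (ZMod s) ⧸ (⊤ : Subgroup (Multiplicative (ZMod s))))
  have h1 : Nonempty (homologyRep s a q ≅ Rep.trivial ℤ (Multiplicative (ZMod s)) ℤ) := by
    refine nonempty_iso_of_bijective (m.repAddHom (AddEquiv.refl ℤ))
      (fun c => ⟨c, Int.cast_id⟩)
      (m.repAddHom_homologyRep (AddEquiv.refl ℤ) _ fun _ => rfl)
      ⟨m.repAddHom_injective _, fun x => (m.mem_range_repAddHom _).2 Submodule.mem_top⟩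
  exact ⟨h1.some ≪≫ (Rep.mkIso E).symm⟩

theorem nonempty_iso_kernel_cosetRepMap {s a q : ℕ} [NeZero s] (h : a ∣ s)
    (m : HomologyModel s a q (translate a) (LinearMap.ker (augmentation a))) :
    Nonempty (homologyRep s a q ≅
      Limits.kernel (cosetRepMap (le_top : cyclicSubgroup s (s / a) ≤ ⊤))) := by
  have he : ∀ x, cosetAddEquiv h (translate a x) =
      Representation.ofMulAction ℤ (Multiplicative (ZMod s))
        (Multiplicative (ZMod s) ⧸ cyclicSubgroup s (s / a)) (Multiplicative.ofAdd 1)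
        (cosetAddEquiv h x) := by
    intro x
    induction x using Finsupp.induction_linear with
    | zero => simp
    | add x y hx hy => rw [map_add, map_add, hx, hy, map_add, map_add]
    | single t c =>
      rw [translate, Finsupp.lmapDomain_apply, Finsupp.mapDomain_single]
      rw [cosetAddEquiv_single, cosetAddEquiv_single, cosetEquiv_add_one,
        Representation.ofMulAction_single]
  have hψ : ∀ x, MonoidAlgebra.mapDomainLinearMap ℤ ℤ
      (Subgroup.quotientMapOfLE (le_top : cyclicSubgroup s (s / a) ≤ ⊤)) (cosetAddEquiv h x) =
      MonoidAlgebra.single 1 (augmentation a x) := by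
    intro x
    induction x using Finsupp.induction_linear with
    | zero => simp
    | add x y hx hy => rw [map_add, map_add, hx, hy, map_add, MonoidAlgebra.single_add]
    | single t c =>
      rw [cosetAddEquiv_single, MonoidAlgebra.mapDomainLinearMap_single]
      congr 1
      · exact QuotientGroup.subsingleton_quotient_top.elim _ _
      · simp [augmentation]
  refine nonempty_iso_kernel (m.repAddHom (cosetAddEquiv h))
    (fun c => ⟨c, Int.cast_id⟩)
    (m.repAddHom_homologyRep (cosetAddEquiv h) _ he) _ (m.repAddHom_injective _) fun v => ?_
  refine Iff.trans ?_ (m.mem_range_repAddHom (cosetAddEquiv h)).symm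
  obtain ⟨x, rfl⟩ := (cosetAddEquiv h).surjective v
  rw [AddEquiv.symm_apply_apply, LinearMap.mem_ker]
  refine Iff.trans (Eq.congr_left (hψ x)) ?_
  exact MonoidAlgebra.single_eq_zero

end TruncatedBar

theorem theorem3p3 (s a : ℕ) [NeZero s] (ha : 1 ≤ a) :
    (¬ a ∣ s →
      Nonempty (TruncatedBar.homologyRep s a (2 * ((s - 1) / a)) ≅
        cosetRep (⊤ : Subgroup (Multiplicative (ZMod s)))) ∧
      ∀ q, q ≠ 2 * ((s - 1) / a) → Limits.IsZero (TruncatedBar.homologyRep s a q)) ∧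
    (a ∣ s →
      Nonempty (TruncatedBar.homologyRep s a (2 * ((s - 1) / a) + 1) ≅
        Limits.kernel (cosetRepMap (le_top : cyclicSubgroup s (s / a) ≤ ⊤))) ∧
      ∀ q, q ≠ 2 * ((s - 1) / a) + 1 → Limits.IsZero (TruncatedBar.homologyRep s a q)) := by
  have hs : 0 < s := Nat.pos_of_ne_zero (NeZero.ne s)
  have hdiv := Nat.div_add_mod' (s - 1) a
  have hlt := Nat.mod_lt (s - 1) (by omega : a > 0)
  set d := (s - 1) / a with hd
  set r := (s - 1) % a with hr
  constructor
  · intro hdvd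
    have hra : r + 1 ≠ a := fun h => hdvd ⟨d + 1, by rw [mul_add, mul_one, mul_comm]; omega⟩
    obtain ⟨m⟩ := TruncatedBar.nonempty_homologyModel_of_not_dvd (a := a) (r := r + 1) (by omega)
      (by omega) (by omega) d
    rw [show r + 1 + d * a = s by omega] at m
    exact ⟨TruncatedBar.nonempty_iso_trivial m,
      fun q hq => TruncatedBar.isZero_homologyRep (m.acyclic q hq)⟩
  · intro hdvd
    have hra : r + 1 = a := by
      have h1 : a ∣ r + 1 := by
        rw [← Nat.dvd_add_right (Dvd.intro_left d rfl : a ∣ d * a), ← add_assoc, hdiv]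
        rwa [Nat.sub_add_cancel hs]
      exact le_antisymm (by omega) (Nat.le_of_dvd (by omega) h1)
    obtain ⟨m⟩ := TruncatedBar.nonempty_homologyModel_of_dvd ha d
    rw [show a + d * a = s by omega] at m
    exact ⟨TruncatedBar.nonempty_iso_kernel_cosetRepMap hdvd m,
      fun q hq => TruncatedBar.isZero_homologyRep (m.acyclic q hq)⟩
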